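/- Let $N\ge 1$, $\delta=\pm1$, let $^*$ denote (entrywise) complex conjugation, let $A,T\in\mathbb{C}^{2N\times 2N}$ be invertible matrices with $AT=TA^*$ and $TT^*=\delta I_{2N}$, and let $C\in\mathbb{C}^{2N}$. For $(x,t)\in\mathbb{R}^2$ put $$\varphi=\exp\Bigl(\tfrac{i}{2}A^2x+\tfrac{i}{2}A^{-2}t\Bigr)C,\qquad \psi=AT\varphi^*,$$ and define the $2N\times 2N$ double Wronskians $$f=|\widetilde N;\widehat{N-1}|=\det\bigl(\partial_x\varphi,\dots,\partial_x^{N}\varphi;\ \psi,\partial_x\psi,\dots,\partial_x^{N-1}\psi\bigr),$$ $$g=|\widehat N;\widetilde{N-1}|=\det\bigl(\varphi,\partial_x\varphi,\dots,\partial_x^{N}\varphi;\ \partial_x\psi,\dots,\partial_x^{N-1}\psi\bigr).$$ Let $D$ be Hirota's operator, $D_x^mD_t^n\,a\cdot b=(\partial_x-\partial_{x'})^m(\partial_t-\partial_{t'})^n a(x,t)\,b(x',t')|_{x'=x,\,t'=t}$. Then: 1. On the open set where $f\neq0$, $u=g/f$ is smooth and solves the classical Fokas–Lenells equation $u_{xt}+u-2i\delta|u|^2u_x=0$.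 2. $f$ and $g$ are smooth on $\mathbb{R}^2$ and satisfy there the bilinear Fokas–Lenells equations $$D_xD_t\,g\cdot f+gf=0,\qquad D_xD_t\,f\cdot f^*+i\delta D_x\,g\cdot g^*=0,\qquad D_t\,f\cdot f^*+i\delta gg^*=0.$$ 3. Where $f\ne0$, $|u|^2=i\delta\bigl(\ln\frac{f}{f^*}\bigr)_t$, for any local continuous branch in $t$ of the logarithm (such a branch exists); and where $\mathrm{Im}\,f\neq0$, $|u|^2=2\delta\bigl(\arctan\frac{\mathrm{Re}\,f}{\mathrm{Im}\,f}\bigr)_t$. -/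

import Mathlib

open Filter Topology Matrix
open scoped ContDiff ComplexConjugate

noncomputable section

namespace FokasLenells

/-- The operator `∂_x - ∂_{x'}` on functions of `(x, t, x', t')`. -/
def dxDiff (F : ℝ → ℝ → ℝ → ℝ → ℂ) : ℝ → ℝ → ℝ → ℝ → ℂ :=
  fun x t x' t' => deriv (fun y => F y t x' t') x - deriv (fun y => F x t y t') x'

/-- The operator `∂_t - ∂_{t'}` on functions of `(x, t, x', t')`. -/
def dtDiff (F : ℝ → ℝ → ℝ → ℝ → ℂ) : ℝ → ℝ → ℝ → ℝ → ℂ :=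
  fun x t x' t' => deriv (fun τ => F x τ x' t') t - deriv (fun τ => F x t x' τ) t'

/-- Hirota's bilinear operator `D_x^m D_t^n a·b`, that is
`(∂_x - ∂_{x'})^m (∂_t - ∂_{t'})^n a(x,t) b(x',t')` restricted to `x' = x`, `t' = t`. -/
def hirota (m n : ℕ) (a b : ℝ → ℝ → ℂ) (x t : ℝ) : ℂ :=
  (dxDiff^[m] (dtDiff^[n] (fun x t x' t' => a x t * b x' t'))) x t x t

/-- The `n × n` double Wronskian whose first `p` columns are
`∂_x^a φ, ∂_x^(a+1) φ, …, ∂_x^(a+p-1) φ` and whose remaining `n - p` columns are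
`∂_x^b ψ, ∂_x^(b+1) ψ, …, ∂_x^(b+n-p-1) ψ`. -/
def doubleWronskian {n : ℕ} (p a b : ℕ) (φ ψ : ℝ → ℝ → Fin n → ℂ) (x t : ℝ) : ℂ :=
  Matrix.det (Matrix.of fun k j : Fin n =>
    if (j : ℕ) < p then iteratedDeriv (a + j) (fun y => φ y t k) x
    else iteratedDeriv (b + (j - p)) (fun y => ψ y t k) x)

/-- Entrywise complex conjugate of a matrix (no transposition). -/
def conjMat {n : ℕ} (A : Matrix (Fin n) (Fin n) ℂ) : Matrix (Fin n) (Fin n) ℂ :=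
  A.map conj

/-- `φ(x,t) = exp((i/2) A² x + (i/2) A⁻² t) C`. -/
def phi {n : ℕ} (A : Matrix (Fin n) (Fin n) ℂ) (C : Fin n → ℂ) (x t : ℝ) : Fin n → ℂ :=
  NormedSpace.exp
    ((Complex.I / 2 * (x : ℂ)) • A ^ 2 + (Complex.I / 2 * (t : ℂ)) • A⁻¹ ^ 2) *ᵥ C

/-- `ψ = A T φ*`. -/
def psi {n : ℕ} (A T : Matrix (Fin n) (Fin n) ℂ) (C : Fin n → ℂ) (x t : ℝ) : Fin n → ℂ :=
  (A * T) *ᵥ (fun k => conj (phi A C x t k))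

/-- `f = |Ñ; N-1^|`, with columns `∂_x φ, …, ∂_x^N φ; ψ, …, ∂_x^(N-1) ψ`. -/
def wronskF {N : ℕ} (A T : Matrix (Fin (2 * N)) (Fin (2 * N)) ℂ) (C : Fin (2 * N) → ℂ) :
    ℝ → ℝ → ℂ :=
  doubleWronskian N 1 0 (phi A C) (psi A T C)

/-- `g = |N^; (N-1)~|`, with columns `φ, …, ∂_x^N φ; ∂_x ψ, …, ∂_x^(N-1) ψ`. -/
def wronskG {N : ℕ} (A T : Matrix (Fin (2 * N)) (Fin (2 * N)) ℂ) (C : Fin (2 * N) → ℂ) :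
    ℝ → ℝ → ℂ :=
  doubleWronskian (N + 1) 0 1 (phi A C) (psi A T C)

/-- `u = g / f` (meaningful where `f ≠ 0`). -/
def solU {N : ℕ} (A T : Matrix (Fin (2 * N)) (Fin (2 * N)) ℂ) (C : Fin (2 * N) → ℂ)
    (x t : ℝ) : ℂ :=
  wronskG A T C x t / wronskF A T C x t

/-- `u` is a smooth solution on the open set `Ω` of the Fokas–Lenells equation
`u_xt + u - 2 i δ |u|² u_x = 0`. -/
def IsFLSolutionOn (δ : ℝ) (Ω : Set (ℝ × ℝ)) (u : ℝ → ℝ → ℂ) : Prop :=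
  IsOpen Ω ∧ ContDiffOn ℝ ∞ (fun p : ℝ × ℝ => u p.1 p.2) Ω ∧
    ∀ x t : ℝ, (x, t) ∈ Ω →
      deriv (fun τ => deriv (fun y => u y τ) x) t + u x t
        - 2 * Complex.I * (δ : ℂ) * ((‖u x t‖ ^ 2 : ℝ) : ℂ) * deriv (fun y => u y t) x = 0

/-- `L` is a continuous branch of `ln r` near `t`. -/
def IsLogBranchNear (L r : ℝ → ℂ) (t : ℝ) : Prop :=
  ∀ᶠ τ in 𝓝 t, ContinuousAt L τ ∧ Complex.exp (L τ) = r τ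

end FokasLenells

end

/-! Put B = (i/2)A². Then φ_x = Bφ and φ_t = -B⁻¹φ/4, and AT = TA* makes ψ satisfy the same system
with both signs reversed. Writing φ_m, ψ_m for the m-th x-derivatives (m any integer, through powers
of B), ∂_x raises an index and -4∂_t lowers it. Determinants of such columns become words. Up to
constants, f is the word φ_1…φ_N ψ_0…ψ_{N-1}; g replaces ψ_0 by φ_0, f* replaces ψ_0 by ψ_N, and g*
replaces φ_1 by ψ_N. The last two use TT* = δI, which gives φ_m* = (AT)⁻¹ψ_m and ψ_m* =
-2iδ(AT)⁻¹φ_{m+1}.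

Two determinant facts carry the proof. Letting B act on one column at a time multiplies a
determinant by tr B (`sum_colDet_update_mulVec`). As B acts on ψ-columns as minus the derivative, a
derivative can be expanded over the columns of one chosen kind only, where almost all terms repeat a
column (`sum_eq_of_kind`). What is left are products of words differing in two columns, which
three-term Plücker relations (`colDet_plucker`) turn into the bilinear identities.

The Fokas–Lenells equation for g/f, and both formulas for |u|², are then algebraic consequences of
the bilinear identities (`isFLSolutionOn_of_bilinear`, `norm_sq_eq_log_deriv`,
`norm_sq_eq_arctan_deriv`). -/

noncomputable section

namespace FokasLenells

/-! ### Determinants as functions of their columns -/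

/-- The determinant of the square matrix with columns `V 0, …, V (n - 1)`. -/
def colDet {n : ℕ} (V : Fin n → Fin n → ℂ) : ℂ := Matrix.det (Matrix.of fun k j => V j k)

lemma colDet_eq_detRowAlternating {n : ℕ} (V : Fin n → Fin n → ℂ) :
    colDet V = Matrix.detRowAlternating V := by
  rw [colDet, ← Matrix.det_transpose]; rfl

lemma of_update_col {n : ℕ} (V : Fin n → Fin n → ℂ) (j : Fin n) (a : Fin n → ℂ) :
    (Matrix.of fun k i => Function.update V j a i k)
      = (Matrix.of fun k i => V i k).updateCol j a := by
  ext k i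
  by_cases h : i = j
  · subst h; simp
  · simp [h]

lemma colDet_update_eq_cramer {n : ℕ} (V : Fin n → Fin n → ℂ) (j : Fin n) (a : Fin n → ℂ) :
    colDet (Function.update V j a) = Matrix.cramer (Matrix.of fun k i => V i k) a j := by
  rw [Matrix.cramer_apply, colDet, of_update_col]

lemma colDet_update_smul {n : ℕ} (V : Fin n → Fin n → ℂ) (j : Fin n) (c : ℂ) (a : Fin n → ℂ) :
    colDet (Function.update V j (c • a)) = c * colDet (Function.update V j a) := by
  simp [colDet_eq_detRowAlternating]

lemma colDet_update_sum {n : ℕ} {ι : Type*} (s : Finset ι) (V : Fin n → Fin n → ℂ) (j : Fin n)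
    (a : ι → Fin n → ℂ) :
    colDet (Function.update V j (∑ i ∈ s, a i))
      = ∑ i ∈ s, colDet (Function.update V j (a i)) := by
  simp only [colDet_eq_detRowAlternating]
  exact (Matrix.detRowAlternating (n := Fin n) (R := ℂ)).map_update_sum _ _ _ _

lemma colDet_eq_zero_of_eq {n : ℕ} (V : Fin n → Fin n → ℂ) {i j : Fin n} (h : V i = V j)
    (hij : i ≠ j) : colDet V = 0 := by
  rw [colDet_eq_detRowAlternating]
  exact AlternatingMap.map_eq_zero_of_eq _ V h hij

lemma colDet_comp_perm {n : ℕ} (V : Fin n → Fin n → ℂ) (σ : Equiv.Perm (Fin n)) :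
    colDet (V ∘ σ) = ((Equiv.Perm.sign σ : ℤ) : ℂ) * colDet V := by
  rw [colDet_eq_detRowAlternating, colDet_eq_detRowAlternating, AlternatingMap.map_perm,
    Units.smul_def, zsmul_eq_mul]

lemma colDet_mulVec {n : ℕ} (M : Matrix (Fin n) (Fin n) ℂ) (V : Fin n → Fin n → ℂ) :
    colDet (fun j => M *ᵥ V j) = M.det * colDet V := by
  rw [colDet, colDet, ← Matrix.det_mul]; rfl

lemma colDet_smul {n : ℕ} (c : Fin n → ℂ) (V : Fin n → Fin n → ℂ) :
    colDet (fun j => c j • V j) = (∏ j, c j) * colDet V := by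
  simp only [colDet_eq_detRowAlternating]
  exact (Matrix.detRowAlternating (n := Fin n) (R := ℂ)).map_smul_univ c V

lemma conj_colDet {n : ℕ} (V : Fin n → Fin n → ℂ) :
    conj (colDet V) = colDet (fun j k => conj (V j k)) := by
  rw [colDet, RingHom.map_det]; rfl

/-- Letting a matrix act on one column at a time multiplies the determinant by its trace. -/
lemma sum_colDet_update_mulVec {n : ℕ} (B : Matrix (Fin n) (Fin n) ℂ)
    (V : Fin n → Fin n → ℂ) :
    ∑ j, colDet (Function.update V j (B *ᵥ V j)) = B.trace * colDet V := by
  set M : Matrix (Fin n) (Fin n) ℂ := Matrix.of fun k i => V i k with hM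
  -- By Cramer's rule each summand is a diagonal entry of adj(M)BM; the trace is cyclic and M adj(M)
  -- = det M.
  have h : ∀ j, colDet (Function.update V j (B *ᵥ V j)) = (M.adjugate * (B * M)) j j := by
    intro j
    rw [colDet_update_eq_cramer, Matrix.cramer_eq_adjugate_mulVec, ← hM]
    rfl
  calc ∑ j, colDet (Function.update V j (B *ᵥ V j)) = (M.adjugate * (B * M)).trace := by
        simp_rw [h]; rfl
    _ = B.trace * colDet V := by
        rw [Matrix.trace_mul_comm, Matrix.mul_assoc, Matrix.mul_adjugate, Matrix.mul_smul,
          Matrix.mul_one, Matrix.trace_smul, smul_eq_mul, mul_comm]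
        rfl

/-- The three-term Plücker relation. -/
lemma colDet_plucker {n : ℕ} (V : Fin n → Fin n → ℂ) {p q : Fin n} (hpq : p ≠ q)
    (c d : Fin n → ℂ) :
    colDet V * colDet (Function.update (Function.update V p c) q d)
      = colDet (Function.update V p c) * colDet (Function.update V q d)
        - colDet (Function.update V q c) * colDet (Function.update V p d) := by
  -- Cramer's rule expands `c` in the columns of `V`; it is then inserted into column `p` of `V`
  -- with `d` at `q`.
  have hc : colDet V • c = ∑ j, colDet (Function.update V j c) • V j := by
    have h := Matrix.mulVec_cramer (Matrix.of fun k i => V i k) c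
    have h2 : colDet V = (Matrix.of fun k i => V i k).det := rfl
    rw [h2, ← h]
    ext k
    simp only [Matrix.mulVec, dotProduct, Finset.sum_apply, Pi.smul_apply, smul_eq_mul,
      colDet_update_eq_cramer, Matrix.of_apply]
    exact Finset.sum_congr rfl fun _ _ => mul_comm _ _
  rw [Function.update_comm hpq, ← colDet_update_smul, hc, colDet_update_sum]
  simp only [colDet_update_smul]
  -- Every other term repeats a column. The term at `q` is a column swap, whence the minus sign.
  rw [← Finset.sum_subset (Finset.subset_univ {p, q}), Finset.sum_pair hpq]
  · have h1 : colDet (Function.update (Function.update V q d) p (V p))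
        = colDet (Function.update V q d) := by
      rw [Function.update_comm hpq.symm, Function.update_eq_self]
    have h2 : colDet (Function.update (Function.update V q d) p (V q))
        = - colDet (Function.update V p d) := by
      have := colDet_comp_perm (Function.update V p d) (Equiv.swap p q)
      rw [Equiv.Perm.sign_swap hpq] at this
      have h3 : Function.update V p d ∘ Equiv.swap p q
          = Function.update (Function.update V q d) p (V q) := by
        ext i k
        by_cases hp : i = p
        · subst hp; simp [hpq.symm]
        · by_cases hq : i = q
          · subst hq; simp [hpq.symm]
          · simp [hp, hq, Equiv.swap_apply_of_ne_of_ne]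
      rw [h3] at this
      simpa using this
    rw [h1, h2]; ring
  · intro j _ hj
    simp only [Finset.mem_insert, Finset.mem_singleton, not_or] at hj
    rw [colDet_eq_zero_of_eq (Function.update (Function.update V q d) p (V j)) (i := j) (j := p)
      (by simp [hj.1, hj.2]) hj.1, mul_zero]

lemma contDiff_colDet {n : ℕ} {E : Type*} [NormedAddCommGroup E] [NormedSpace ℝ E]
    {V : Fin n → E → Fin n → ℂ} (hV : ∀ j, ContDiff ℝ ∞ (V j)) :
    ContDiff ℝ ∞ fun p => colDet fun j => V j p := by
  simp only [colDet, Matrix.det_apply, Matrix.of_apply, Units.smul_def, zsmul_eq_mul]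
  refine ContDiff.sum fun σ _ => contDiff_const.mul (contDiff_prod fun i _ => ?_)
  exact contDiff_pi.1 (hV i) (σ i)

lemma hasDerivAt_colDet {n : ℕ} {V : ℝ → Fin n → Fin n → ℂ} {V' : Fin n → Fin n → ℂ} {x : ℝ}
    (hV : ∀ j, HasDerivAt (fun y => V y j) (V' j) x) :
    HasDerivAt (fun y => colDet (V y)) (∑ j, colDet (Function.update (V x) j (V' j))) x := by
  let D : ContinuousMultilinearMap ℝ (fun _ : Fin n => Fin n → ℂ) ℂ :=
    { toMultilinearMap :=
        (Matrix.detRowAlternating (n := Fin n) (R := ℂ)).toMultilinearMap.restrictScalars ℝ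
      cont := by
        change Continuous fun M : Matrix (Fin n) (Fin n) ℂ => M.det
        fun_prop }
  have hD : ∀ W, D W = colDet W := fun W => (colDet_eq_detRowAlternating W).symm
  have h := HasFDerivAt.multilinear_comp (f := D) (g := fun j y => V y j)
    (fun j => (hV j).hasFDerivAt)
  have h2 := h.hasDerivAt
  simp only [hD] at h2
  convert! h2 using 1
  simp [hD]

/-! ### A calculus of double Wronskians

A column `∂_x^m φ` is encoded by the letter `(true, m)` and a column `∂_x^m ψ` by the letter
`(false, m)`; negative `m` are allowed. -/

/-- The sign attached to the two kinds of columns. -/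
def sgn (b : Bool) : ℂ := if b then 1 else -1

@[simp] lemma sgn_true : sgn true = 1 := rfl

@[simp] lemma sgn_false : sgn false = -1 := rfl

lemma sgn_mul_self (b : Bool) : sgn b * sgn b = 1 := by cases b <;> simp

lemma sgn_ne_zero (b : Bool) : sgn b ≠ 0 := by cases b <;> simp

/-- The pair `Y true, Y false` solves `∂_x Y = ± B Y`, `∂_t Y = ∓ B⁻¹ Y / 4`. -/
structure IsFlow {n : ℕ} (B : Matrix (Fin n) (Fin n) ℂ) (Y : Bool → ℝ → ℝ → Fin n → ℂ) :
    Prop where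
  isUnit_det : IsUnit B.det
  hasDerivAt_fst : ∀ b x t, HasDerivAt (fun y => Y b y t) (sgn b • (B *ᵥ Y b x t)) x
  hasDerivAt_snd : ∀ b x t,
    HasDerivAt (fun τ => Y b x τ) ((-(1 / 4) : ℂ) • sgn b • (B⁻¹ *ᵥ Y b x t)) t
  contDiff : ∀ b, ContDiff ℝ ∞ fun p : ℝ × ℝ => Y b p.1 p.2

/-- The letter of the `x`-derivative of a column. -/
def up (a : Bool × ℤ) : Bool × ℤ := (a.1, a.2 + 1)

/-- The letter of the `x`-antiderivative of a column. -/
def down (a : Bool × ℤ) : Bool × ℤ := (a.1, a.2 - 1)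

@[simp] lemma up_mk (b : Bool) (m : ℤ) : up (b, m) = (b, m + 1) := rfl

@[simp] lemma down_mk (b : Bool) (m : ℤ) : down (b, m) = (b, m - 1) := rfl

@[simp] lemma down_fst (a : Bool × ℤ) : (down a).1 = a.1 := rfl

@[simp] lemma up_down (a : Bool × ℤ) : up (down a) = a := by simp [up, down]

section WordCalculus

variable {n : ℕ} {B : Matrix (Fin n) (Fin n) ℂ} {Y : Bool → ℝ → ℝ → Fin n → ℂ}

/-- The column with a given letter. -/
def col (B : Matrix (Fin n) (Fin n) ℂ) (Y : Bool → ℝ → ℝ → Fin n → ℂ) (a : Bool × ℤ)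
    (x t : ℝ) : Fin n → ℂ :=
  (sgn a.1 ^ a.2) • ((B ^ a.2) *ᵥ Y a.1 x t)

/-- `B` is the x-derivative on φ-columns and minus it on ψ-columns; this mismatch is what makes the
trace identity useful. -/
lemma IsFlow.mulVec_col (h : IsFlow B Y) (a : Bool × ℤ) (x t : ℝ) :
    B *ᵥ col B Y a x t = sgn a.1 • col B Y (up a) x t := by
  have h1 : B ^ (a.2 + 1) = B * B ^ a.2 := by
    rw [add_comm, Matrix.zpow_one_add h.isUnit_det]
  rw [col, col, up, h1, zpow_add_one₀ (sgn_ne_zero _), Matrix.mulVec_smul, smul_smul,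
    Matrix.mulVec_mulVec, mul_comm (sgn a.1), mul_assoc, sgn_mul_self, mul_one]

lemma IsFlow.inv_mulVec_col (h : IsFlow B Y) (a : Bool × ℤ) (x t : ℝ) :
    B⁻¹ *ᵥ col B Y a x t = sgn a.1 • col B Y (down a) x t := by
  have h1 := h.mulVec_col (down a) x t
  rw [up_down, down_fst] at h1
  have h2 : col B Y a x t = sgn a.1 • (B *ᵥ col B Y (down a) x t) := by
    rw [h1, smul_smul, sgn_mul_self, one_smul]
  rw [h2, Matrix.mulVec_smul, Matrix.mulVec_mulVec, Matrix.nonsing_inv_mul _ h.isUnit_det,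
    Matrix.one_mulVec]

lemma hasDerivAt_mulVec (M : Matrix (Fin n) (Fin n) ℂ) {v : ℝ → Fin n → ℂ} {v' : Fin n → ℂ}
    {x : ℝ} (h : HasDerivAt v v' x) : HasDerivAt (fun y => M *ᵥ v y) (M *ᵥ v') x := by
  rw [hasDerivAt_pi] at h ⊢
  intro k
  simp only [Matrix.mulVec, dotProduct]
  exact HasDerivAt.fun_sum fun j _ => (h j).const_mul (M k j)

lemma IsFlow.hasDerivAt_col_fst (h : IsFlow B Y) (a : Bool × ℤ) (x t : ℝ) :
    HasDerivAt (fun y => col B Y a y t) (col B Y (up a) x t) x := by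
  have h1 := (hasDerivAt_mulVec (B ^ a.2) (h.hasDerivAt_fst a.1 x t)).const_smul (sgn a.1 ^ a.2)
  convert! h1 using 1
  have h2 : B ^ (a.2 + 1) = B ^ a.2 * B := Matrix.zpow_add_one h.isUnit_det _
  rw [col, up, h2, zpow_add_one₀ (sgn_ne_zero _), Matrix.mulVec_smul, smul_smul,
    Matrix.mulVec_mulVec]

lemma IsFlow.hasDerivAt_col_snd (h : IsFlow B Y) (a : Bool × ℤ) (x t : ℝ) :
    HasDerivAt (fun τ => col B Y a x τ) ((-(1 / 4) : ℂ) • col B Y (down a) x t) t := by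
  have h1 := (hasDerivAt_mulVec (B ^ a.2) (h.hasDerivAt_snd a.1 x t)).const_smul (sgn a.1 ^ a.2)
  convert! h1 using 1
  have h2 : B ^ (a.2 - 1) = B ^ a.2 * B⁻¹ := Matrix.zpow_sub_one h.isUnit_det _
  have h3 : sgn a.1 ^ (a.2 - 1) = sgn a.1 ^ a.2 * sgn a.1 := by
    rw [zpow_sub_one₀ (sgn_ne_zero _), inv_eq_of_mul_eq_one_left (sgn_mul_self _)]
  rw [col, down, h2, h3, Matrix.mulVec_smul, Matrix.mulVec_smul, smul_smul, smul_smul, smul_smul,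
    Matrix.mulVec_mulVec]
  congr 1
  ring

lemma IsFlow.contDiff_col (h : IsFlow B Y) (a : Bool × ℤ) :
    ContDiff ℝ ∞ fun p : ℝ × ℝ => col B Y a p.1 p.2 := by
  refine contDiff_pi.2 fun k => ?_
  simp only [col, Pi.smul_apply, smul_eq_mul, Matrix.mulVec, dotProduct]
  exact contDiff_const.mul
    (ContDiff.sum fun j _ => contDiff_const.mul (contDiff_pi.1 (h.contDiff a.1) j))

/-- The determinant whose columns are spelled by the word `w`. -/
def wordDet (B : Matrix (Fin n) (Fin n) ℂ) (Y : Bool → ℝ → ℝ → Fin n → ℂ)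
    (w : Fin n → Bool × ℤ) (x t : ℝ) : ℂ :=
  colDet fun j => col B Y (w j) x t

lemma col_update (w : Fin n → Bool × ℤ) (j : Fin n) (a : Bool × ℤ) (x t : ℝ) :
    (fun i => col B Y (Function.update w j a i) x t)
      = Function.update (fun i => col B Y (w i) x t) j (col B Y a x t) := by
  ext i k
  by_cases h : i = j
  · subst h; simp
  · simp [h]

lemma wordDet_update (w : Fin n → Bool × ℤ) (j : Fin n) (a : Bool × ℤ) (x t : ℝ) :
    wordDet B Y (Function.update w j a) x t
      = colDet (Function.update (fun i => col B Y (w i) x t) j (col B Y a x t)) := by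
  rw [wordDet, col_update]

lemma wordDet_eq_zero {w : Fin n → Bool × ℤ} {i j : Fin n} (h : w i = w j) (hij : i ≠ j)
    (x t : ℝ) : wordDet B Y w x t = 0 :=
  colDet_eq_zero_of_eq _ (by simp [h]) hij

lemma wordDet_comp_perm (w : Fin n → Bool × ℤ) (σ : Equiv.Perm (Fin n)) (x t : ℝ) :
    wordDet B Y (w ∘ σ) x t = ((Equiv.Perm.sign σ : ℤ) : ℂ) * wordDet B Y w x t :=
  colDet_comp_perm (fun j => col B Y (w j) x t) σ

lemma wordDet_plucker (w : Fin n → Bool × ℤ) {p q : Fin n} (hpq : p ≠ q) (c d : Bool × ℤ)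
    (x t : ℝ) :
    wordDet B Y w x t * wordDet B Y (Function.update (Function.update w p c) q d) x t
      = wordDet B Y (Function.update w p c) x t * wordDet B Y (Function.update w q d) x t
        - wordDet B Y (Function.update w q c) x t * wordDet B Y (Function.update w p d) x t := by
  simp only [wordDet, col_update]
  exact colDet_plucker _ hpq _ _

lemma IsFlow.contDiff_wordDet (h : IsFlow B Y) (w : Fin n → Bool × ℤ) :
    ContDiff ℝ ∞ fun p : ℝ × ℝ => wordDet B Y w p.1 p.2 :=
  contDiff_colDet fun j => h.contDiff_col (w j)

lemma IsFlow.trace_mul_wordDet (h : IsFlow B Y) (w : Fin n → Bool × ℤ) (x t : ℝ) :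
    B.trace * wordDet B Y w x t
      = ∑ j, sgn (w j).1 * wordDet B Y (Function.update w j (up (w j))) x t := by
  rw [wordDet, ← sum_colDet_update_mulVec]
  refine Finset.sum_congr rfl fun j _ => ?_
  rw [h.mulVec_col, colDet_update_smul, wordDet_update]

lemma IsFlow.trace_inv_mul_wordDet (h : IsFlow B Y) (w : Fin n → Bool × ℤ) (x t : ℝ) :
    B⁻¹.trace * wordDet B Y w x t
      = ∑ j, sgn (w j).1 * wordDet B Y (Function.update w j (down (w j))) x t := by
  rw [wordDet, ← sum_colDet_update_mulVec]
  refine Finset.sum_congr rfl fun j _ => ?_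
  rw [h.inv_mulVec_col, colDet_update_smul, wordDet_update]

lemma IsFlow.hasDerivAt_wordDet_fst (h : IsFlow B Y) (w : Fin n → Bool × ℤ) (x t : ℝ) :
    HasDerivAt (fun y => wordDet B Y w y t)
      (∑ j, wordDet B Y (Function.update w j (up (w j))) x t) x := by
  simp only [wordDet_update]
  exact hasDerivAt_colDet (V := fun y j => col B Y (w j) y t)
    fun j => h.hasDerivAt_col_fst (w j) x t

lemma IsFlow.hasDerivAt_wordDet_snd (h : IsFlow B Y) (w : Fin n → Bool × ℤ) (x t : ℝ) :
    HasDerivAt (fun τ => wordDet B Y w x τ)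
      (-(1 / 4) * ∑ j, wordDet B Y (Function.update w j (down (w j))) x t) t := by
  have h1 := hasDerivAt_colDet (V := fun τ j => col B Y (w j) x τ)
    fun j => h.hasDerivAt_col_snd (w j) x t
  simp only [colDet_update_smul] at h1
  simp only [wordDet_update, Finset.mul_sum]
  exact h1

/-- Up to a multiple of the trace, a derivative only sees the columns of the kind `b`, and among
them only those, indexed by `S`, whose derivative is not another column. -/
lemma sum_eq_of_kind (w : Fin n → Bool × ℤ) (r : Bool × ℤ → Bool × ℤ) (b : Bool)
    (S : Finset (Fin n)) (hS : ∀ j ∈ S, (w j).1 = b)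
    (hw : ∀ j, j ∉ S → (w j).1 = b → ∃ k, k ≠ j ∧ w k = r (w j)) (x t : ℝ) {T : ℂ}
    (hT : T = ∑ j, sgn (w j).1 * wordDet B Y (Function.update w j (r (w j))) x t) :
    ∑ j, wordDet B Y (Function.update w j (r (w j))) x t
      = -sgn b * T + 2 * ∑ j ∈ S, wordDet B Y (Function.update w j (r (w j))) x t := by
  classical
  have hsum : ∑ j ∈ S, wordDet B Y (Function.update w j (r (w j))) x t
      = ∑ j, if j ∈ S then wordDet B Y (Function.update w j (r (w j))) x t else 0 := by
    simp
  -- Compared termwise: a column of the other kind comes once from the trace, a column in `S` counts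
  -- -1 + 2 = 1, and the remaining ones give a repeated column.
  rw [hT, hsum, Finset.mul_sum, Finset.mul_sum, ← Finset.sum_add_distrib]
  refine Finset.sum_congr rfl fun j _ => ?_
  have key : (w j).1 = b → j ∉ S → wordDet B Y (Function.update w j (r (w j))) x t = 0 := by
    intro hb hj
    obtain ⟨k, hkj, hk⟩ := hw j hj hb
    exact wordDet_eq_zero (i := k) (j := j) (by simp [hkj, hk]) hkj x t
  by_cases hj : j ∈ S
  · rw [if_pos hj, hS j hj]
    linear_combination (wordDet B Y (Function.update w j (r (w j))) x t) * sgn_mul_self b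
  · rw [if_neg hj]
    by_cases hb : (w j).1 = b
    · simp [key hb hj]
    · have h2 : -sgn b * sgn (w j).1 = 1 := by
        revert hb; cases b <;> cases (w j).1 <;> simp
      rw [← mul_assoc, h2]; ring

lemma IsFlow.trace_inv_mul_wordDet_of_pair (h : IsFlow B Y) (w : Fin n → Bool × ℤ) {p q : Fin n}
    (hpq : p ≠ q) (hw : ∀ j, j ≠ p → j ≠ q → ∃ k, k ≠ j ∧ w k = down (w j)) (x t : ℝ) :
    B⁻¹.trace * wordDet B Y w x t
      = sgn (w p).1 * wordDet B Y (Function.update w p (down (w p))) x t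
        + sgn (w q).1 * wordDet B Y (Function.update w q (down (w q))) x t := by
  rw [h.trace_inv_mul_wordDet, ← Finset.sum_subset (Finset.subset_univ {p, q}),
    Finset.sum_pair hpq]
  intro j _ hj
  simp only [Finset.mem_insert, Finset.mem_singleton, not_or] at hj
  obtain ⟨k, hkj, hk⟩ := hw j hj.1 hj.2
  rw [wordDet_eq_zero (i := k) (j := j) (by simp [hkj, hk]) hkj x t, mul_zero]

lemma IsFlow.hasDerivAt_fst_of_kind (h : IsFlow B Y) (w : Fin n → Bool × ℤ) (b : Bool)
    (S : Finset (Fin n)) (hS : ∀ j ∈ S, (w j).1 = b)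
    (hw : ∀ j, j ∉ S → (w j).1 = b → ∃ k, k ≠ j ∧ w k = up (w j)) (x t : ℝ) :
    HasDerivAt (fun y => wordDet B Y w y t)
      (-sgn b * (B.trace * wordDet B Y w x t)
        + 2 * ∑ j ∈ S, wordDet B Y (Function.update w j (up (w j))) x t) x := by
  rw [← sum_eq_of_kind w up b S hS hw x t (h.trace_mul_wordDet w x t)]
  exact h.hasDerivAt_wordDet_fst w x t

lemma IsFlow.hasDerivAt_snd_of_kind (h : IsFlow B Y) (w : Fin n → Bool × ℤ) (b : Bool)
    (S : Finset (Fin n)) (hS : ∀ j ∈ S, (w j).1 = b)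
    (hw : ∀ j, j ∉ S → (w j).1 = b → ∃ k, k ≠ j ∧ w k = down (w j)) (x t : ℝ) :
    HasDerivAt (fun τ => wordDet B Y w x τ)
      (-(1 / 4) * (-sgn b * (B⁻¹.trace * wordDet B Y w x t)
        + 2 * ∑ j ∈ S, wordDet B Y (Function.update w j (down (w j))) x t)) t := by
  rw [← sum_eq_of_kind w down b S hS hw x t (h.trace_inv_mul_wordDet w x t)]
  exact h.hasDerivAt_wordDet_snd w x t

end WordCalculus

/-! ### The words of the solution -/

/-- The word `φ₁ ⋯ φ_N ψ₀ ⋯ ψ_{N-1}`. -/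
def fWord (N : ℕ) (j : Fin (2 * N)) : Bool × ℤ :=
  if (j : ℕ) < N then (true, (j : ℤ) + 1) else (false, (j : ℤ) - N)

section Words

variable {N : ℕ} (hN : 1 ≤ N)

/-- The position of `φ₁`. -/
def posFirst : Fin (2 * N) := ⟨0, by omega⟩

/-- The position of `φ_N`. -/
def posLast : Fin (2 * N) := ⟨N - 1, by omega⟩

/-- The position of `ψ₀`. -/
def posPsi : Fin (2 * N) := ⟨N, by omega⟩

lemma posFirst_ne_posPsi : posFirst hN ≠ posPsi hN := by
  simp only [posFirst, posPsi, ne_eq, Fin.mk.injEq]; omega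

lemma posLast_ne_posPsi : posLast hN ≠ posPsi hN := by
  simp only [posLast, posPsi, ne_eq, Fin.mk.injEq]; omega

/-- The word of `f` with `ψ₀` replaced by `a`. -/
def psiWord (a : Bool × ℤ) : Fin (2 * N) → Bool × ℤ :=
  Function.update (fWord N) (posPsi hN) a

/-- The word of `f` with `φ₁` replaced by `b` and `ψ₀` by `a`. -/
def firstWord (b a : Bool × ℤ) : Fin (2 * N) → Bool × ℤ :=
  Function.update (Function.update (fWord N) (posFirst hN) b) (posPsi hN) a

/-- The word of `f` with `φ_N` replaced by `b` and `ψ₀` by `a`. -/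
def lastWord (b a : Bool × ℤ) : Fin (2 * N) → Bool × ℤ :=
  Function.update (Function.update (fWord N) (posLast hN) b) (posPsi hN) a

variable {B : Matrix (Fin (2 * N)) (Fin (2 * N)) ℂ} {Y : Bool → ℝ → ℝ → Fin (2 * N) → ℂ}

lemma fWord_posFirst : fWord N (posFirst hN) = (true, 1) := by
  rw [fWord, if_pos (show ((posFirst hN : Fin (2 * N)) : ℕ) < N from hN)]
  simp [posFirst]

lemma fWord_posLast : fWord N (posLast hN) = (true, (N : ℤ)) := by
  have h : ((posLast hN : Fin (2 * N)) : ℕ) = N - 1 := rfl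
  rw [fWord, h, if_pos (by omega), Prod.mk.injEq]
  exact ⟨rfl, by omega⟩

lemma psiWord_posPsi (a : Bool × ℤ) : psiWord hN a (posPsi hN) = a := by simp [psiWord]

lemma psiWord_psi_zero : psiWord hN (false, 0) = fWord N := by
  rw [psiWord, Function.update_eq_self_iff]; simp [fWord, posPsi]

lemma firstWord_phi_one (a : Bool × ℤ) : firstWord hN (true, 1) a = psiWord hN a := by
  have h : Function.update (fWord N) (posFirst hN) (true, 1) = fWord N := by
    rw [Function.update_eq_self_iff, fWord_posFirst]
  rw [firstWord, psiWord, h]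

lemma psiWord_posFirst (a : Bool × ℤ) : psiWord hN a (posFirst hN) = (true, 1) := by
  rw [psiWord, Function.update_of_ne (posFirst_ne_posPsi hN), fWord_posFirst]

lemma psiWord_posLast (a : Bool × ℤ) : psiWord hN a (posLast hN) = (true, (N : ℤ)) := by
  rw [psiWord, Function.update_of_ne (posLast_ne_posPsi hN), fWord_posLast]

lemma firstWord_posPsi (b a : Bool × ℤ) : firstWord hN b a (posPsi hN) = a := by
  simp [firstWord]

lemma firstWord_posFirst (b a : Bool × ℤ) : firstWord hN b a (posFirst hN) = b := by
  simp [firstWord, posFirst_ne_posPsi hN]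

lemma lastWord_posPsi (b a : Bool × ℤ) : lastWord hN b a (posPsi hN) = a := by
  simp [lastWord]

lemma lastWord_posLast (b a : Bool × ℤ) : lastWord hN b a (posLast hN) = b := by
  simp [lastWord, posLast_ne_posPsi hN]

lemma update_psiWord_posPsi (a c : Bool × ℤ) :
    Function.update (psiWord hN a) (posPsi hN) c = psiWord hN c := by
  simp [psiWord]

lemma update_psiWord_posFirst (a c : Bool × ℤ) :
    Function.update (psiWord hN a) (posFirst hN) c = firstWord hN c a := by
  rw [psiWord, firstWord, Function.update_comm (posFirst_ne_posPsi hN)]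

lemma update_psiWord_posLast (a c : Bool × ℤ) :
    Function.update (psiWord hN a) (posLast hN) c = lastWord hN c a := by
  rw [psiWord, lastWord, Function.update_comm (posLast_ne_posPsi hN)]

lemma update_firstWord_posPsi (b a c : Bool × ℤ) :
    Function.update (firstWord hN b a) (posPsi hN) c = firstWord hN b c := by
  simp [firstWord]

lemma update_firstWord_posFirst (b a c : Bool × ℤ) :
    Function.update (firstWord hN b a) (posFirst hN) c = firstWord hN c a := by
  rw [firstWord, firstWord, Function.update_comm (posFirst_ne_posPsi hN).symm,
    Function.update_idem]

lemma update_lastWord_posPsi (b a c : Bool × ℤ) :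
    Function.update (lastWord hN b a) (posPsi hN) c = lastWord hN b c := by
  simp [lastWord]

lemma update_lastWord_posLast (b a c : Bool × ℤ) :
    Function.update (lastWord hN b a) (posLast hN) c = lastWord hN c a := by
  rw [lastWord, lastWord, Function.update_comm (posLast_ne_posPsi hN).symm,
    Function.update_idem]

/-! ### Derivatives of the words behind f, g and their conjugates -/

lemma IsFlow.hasDerivAt_psiWord_psi_fst (h : IsFlow B Y) (m : ℤ) (x t : ℝ) :
    HasDerivAt (fun y => wordDet B Y (psiWord hN (false, m)) y t)
      (-(B.trace * wordDet B Y (psiWord hN (false, m)) x t)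
        + 2 * wordDet B Y (lastWord hN (true, N + 1) (false, m)) x t) x := by
  convert! h.hasDerivAt_fst_of_kind (psiWord hN (false, m)) true {posLast hN} ?_ ?_ x t using 1
  · simp [psiWord_posLast, update_psiWord_posLast]
  · simp [psiWord_posLast]
  · rintro ⟨j, hj2⟩ hj hb
    simp only [psiWord, Function.update_apply, fWord, Fin.ext_iff, posPsi, posLast,
      Finset.mem_singleton, ne_eq] at hj hb ⊢
    have hjN : j < N := by
      split_ifs at hb; omega
    -- In the block φ_1…φ_N each derivative is the right neighbour; only φ_N leaves the block.
    refine ⟨⟨j + 1, by omega⟩, by simp only; omega, ?_⟩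
    simp only [up]
    split_ifs <;> first
      | contradiction
      | omega
      | (simp only [Prod.mk.injEq, true_and]; omega)

/-- Besides φ_N the extra column φ_m moves. For m = 0 it repeats φ_1; for m = -1 it restores the
word of g, the source of the term gf. -/
lemma IsFlow.hasDerivAt_psiWord_phi_fst (h : IsFlow B Y) (m : ℤ) (x t : ℝ) :
    HasDerivAt (fun y => wordDet B Y (psiWord hN (true, m)) y t)
      (-(B.trace * wordDet B Y (psiWord hN (true, m)) x t)
        + 2 * (wordDet B Y (lastWord hN (true, N + 1) (true, m)) x t
          + wordDet B Y (psiWord hN (true, m + 1)) x t)) x := by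
  convert! h.hasDerivAt_fst_of_kind (psiWord hN (true, m)) true {posLast hN, posPsi hN} ?_ ?_ x t
    using 1
  · rw [Finset.sum_pair (posLast_ne_posPsi hN)]
    simp [psiWord_posLast, psiWord_posPsi, update_psiWord_posLast, update_psiWord_posPsi]
  · simp [psiWord_posLast, psiWord_posPsi]
  · rintro ⟨j, hj2⟩ hj hb
    simp only [psiWord, Function.update_apply, fWord, Fin.ext_iff, posPsi, posLast,
      Finset.mem_insert, Finset.mem_singleton, ne_eq] at hj hb ⊢
    have hjN : j < N := by
      split_ifs at hb <;> omega
    refine ⟨⟨j + 1, by omega⟩, by simp only; omega, ?_⟩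
    simp only [up]
    split_ifs <;> first
      | contradiction
      | omega
      | (simp only [Prod.mk.injEq, true_and]; omega)

/-- Expanded over the ψ-columns, which are ψ_1, …, ψ_N, so only ψ_N moves and k is free: k = 1 is
the word of f*, k = 0 occurs in its t-derivative. -/
lemma IsFlow.hasDerivAt_firstWord_fst (h : IsFlow B Y) (k : ℤ) (x t : ℝ) :
    HasDerivAt (fun y => wordDet B Y (firstWord hN (true, k) (false, N)) y t)
      (B.trace * wordDet B Y (firstWord hN (true, k) (false, N)) x t
        + 2 * wordDet B Y (firstWord hN (true, k) (false, N + 1)) x t) x := by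
  convert! h.hasDerivAt_fst_of_kind (firstWord hN (true, k) (false, N)) false {posPsi hN} ?_ ?_ x t
    using 1
  · simp [firstWord_posPsi, update_firstWord_posPsi]
  · simp [firstWord_posPsi]
  · rintro ⟨j, hj2⟩ hj hb
    simp only [firstWord, Function.update_apply, fWord, Fin.ext_iff, posPsi, posFirst,
      Finset.mem_singleton, ne_eq] at hj hb ⊢
    have hjN : N < j := by
      split_ifs at hb; omega
    rcases lt_or_ge (j + 1) (2 * N) with h1 | h1
    · refine ⟨⟨j + 1, by omega⟩, by simp only; omega, ?_⟩
      simp only [up]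
      split_ifs <;> first
        | contradiction
        | omega
        | (simp only [Prod.mk.injEq, true_and]; omega)
    -- The last position holds ψ_{N-1}, whose derivative ψ_N sits in the old place of ψ_0.
    · refine ⟨⟨N, by omega⟩, by simp only; omega, ?_⟩
      simp only [up]
      split_ifs <;> first
        | contradiction
        | omega
        | (simp only [Prod.mk.injEq, true_and]; omega)

/-- In the word of g* the ψ-columns are ψ_0, …, ψ_N, the top one standing first. -/
lemma IsFlow.hasDerivAt_firstWord_psi_fst (h : IsFlow B Y) (x t : ℝ) :
    HasDerivAt (fun y => wordDet B Y (firstWord hN (false, N) (false, 0)) y t)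
      (B.trace * wordDet B Y (firstWord hN (false, N) (false, 0)) x t
        + 2 * wordDet B Y (firstWord hN (false, N + 1) (false, 0)) x t) x := by
  convert! h.hasDerivAt_fst_of_kind (firstWord hN (false, N) (false, 0)) false {posFirst hN}
    ?_ ?_ x t using 1
  · simp [firstWord_posFirst, update_firstWord_posFirst]
  · simp [firstWord_posFirst]
  · rintro ⟨j, hj2⟩ hj hb
    simp only [firstWord, Function.update_apply, fWord, Fin.ext_iff, posPsi, posFirst,
      Finset.mem_singleton, ne_eq] at hj hb ⊢
    have hjN : N ≤ j := by
      split_ifs at hb <;> omega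
    rcases lt_or_ge (j + 1) (2 * N) with h1 | h1
    · refine ⟨⟨j + 1, by omega⟩, by simp only; omega, ?_⟩
      simp only [up]
      split_ifs <;> first
        | contradiction
        | omega
        | (simp only [Prod.mk.injEq, true_and]; omega)
    · refine ⟨⟨0, by omega⟩, by simp only; omega, ?_⟩
      simp only [up]
      split_ifs <;> first
        | contradiction
        | omega
        | (simp only [Prod.mk.injEq, true_and]; omega)

lemma IsFlow.hasDerivAt_psiWord_psi_snd (h : IsFlow B Y) (m : ℤ) (x t : ℝ) :
    HasDerivAt (fun τ => wordDet B Y (psiWord hN (false, m)) x τ)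
      (-(1 / 4) * (-(B⁻¹.trace * wordDet B Y (psiWord hN (false, m)) x t)
        + 2 * wordDet B Y (firstWord hN (true, 0) (false, m)) x t)) t := by
  convert! h.hasDerivAt_snd_of_kind (psiWord hN (false, m)) true {posFirst hN} ?_ ?_ x t using 1
  · simp [psiWord_posFirst, update_psiWord_posFirst]
  · simp [psiWord_posFirst]
  · rintro ⟨j, hj2⟩ hj hb
    simp only [psiWord, Function.update_apply, fWord, Fin.ext_iff, posPsi, posFirst,
      Finset.mem_singleton, ne_eq] at hj hb ⊢
    have hjN : 0 < j ∧ j < N := by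
      split_ifs at hb; omega
    refine ⟨⟨j - 1, by omega⟩, by simp only; omega, ?_⟩
    simp only [down]
    split_ifs <;> first
      | contradiction
      | omega
      | (simp only [Prod.mk.injEq, true_and]; omega)

/-- The t-derivative of f again, but expanded over ψ: the changed column stays in the ψ_0 position,
as the Plücker relations in `IsFlow.bilinear_first` require. -/
lemma IsFlow.hasDerivAt_psiWord_psi_zero_snd (h : IsFlow B Y) (x t : ℝ) :
    HasDerivAt (fun τ => wordDet B Y (psiWord hN (false, 0)) x τ)
      (-(1 / 4) * (B⁻¹.trace * wordDet B Y (psiWord hN (false, 0)) x t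
        + 2 * wordDet B Y (psiWord hN (false, -1)) x t)) t := by
  convert! h.hasDerivAt_snd_of_kind (psiWord hN (false, 0)) false {posPsi hN} ?_ ?_ x t using 1
  · simp [psiWord_posPsi, update_psiWord_posPsi]
  · simp [psiWord_posPsi]
  · rintro ⟨j, hj2⟩ hj hb
    simp only [psiWord, Function.update_apply, fWord, Fin.ext_iff, posPsi,
      Finset.mem_singleton, ne_eq] at hj hb ⊢
    have hjN : N < j := by
      split_ifs at hb; omega
    refine ⟨⟨j - 1, by omega⟩, by simp only; omega, ?_⟩
    simp only [down]
    split_ifs <;> first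
      | contradiction
      | omega
      | (simp only [Prod.mk.injEq, true_and]; omega)

lemma IsFlow.hasDerivAt_psiWord_phi_zero_snd (h : IsFlow B Y) (x t : ℝ) :
    HasDerivAt (fun τ => wordDet B Y (psiWord hN (true, 0)) x τ)
      (-(1 / 4) * (-(B⁻¹.trace * wordDet B Y (psiWord hN (true, 0)) x t)
        + 2 * wordDet B Y (psiWord hN (true, -1)) x t)) t := by
  convert! h.hasDerivAt_snd_of_kind (psiWord hN (true, 0)) true {posPsi hN} ?_ ?_ x t using 1
  · simp [psiWord_posPsi, update_psiWord_posPsi]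
  · simp [psiWord_posPsi]
  · rintro ⟨j, hj2⟩ hj hb
    simp only [psiWord, Function.update_apply, fWord, Fin.ext_iff, posPsi,
      Finset.mem_singleton, ne_eq] at hj hb ⊢
    have hjN : j < N := by
      split_ifs at hb; omega
    -- Lowering φ_1 gives φ_0, which occupies position N.
    rcases Nat.eq_zero_or_pos j with h1 | h1
    · refine ⟨⟨N, by omega⟩, by simp only; omega, ?_⟩
      simp only [down]
      split_ifs <;> first
        | contradiction
        | omega
        | (simp only [Prod.mk.injEq, true_and]; omega)
    · refine ⟨⟨j - 1, by omega⟩, by simp only; omega, ?_⟩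
      simp only [down]
      split_ifs <;> first
        | contradiction
        | omega
        | (simp only [Prod.mk.injEq, true_and]; omega)

/-- The trace of `B⁻¹` on the word `φ₀ ⋯ φ_{N-1} ψ₀ ⋯ ψ_{N-1}`. -/
lemma IsFlow.trace_inv_mul_lastWord (h : IsFlow B Y) (x t : ℝ) :
    B⁻¹.trace * wordDet B Y (lastWord hN (true, 0) (false, 0)) x t
      = wordDet B Y (lastWord hN (true, -1) (false, 0)) x t
        - wordDet B Y (lastWord hN (true, 0) (false, -1)) x t := by
  rw [h.trace_inv_mul_wordDet_of_pair _ (posLast_ne_posPsi hN)]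
  · simp [lastWord_posPsi, lastWord_posLast, update_lastWord_posPsi, update_lastWord_posLast,
      sub_eq_add_neg]
  · rintro ⟨j, hj2⟩ hj hb
    simp only [lastWord, Function.update_apply, fWord, Fin.ext_iff, posPsi, posLast,
      ne_eq] at hj hb ⊢
    rcases Nat.eq_zero_or_pos j with h1 | h1
    · refine ⟨⟨N - 1, by omega⟩, by simp only; omega, ?_⟩
      simp only [down]
      split_ifs <;> first
        | contradiction
        | omega
        | (simp only [Prod.mk.injEq, true_and]; omega)
    · refine ⟨⟨j - 1, by omega⟩, by simp only; omega, ?_⟩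
      simp only [down]
      split_ifs <;> first
        | contradiction
        | omega
        | (simp only [Prod.mk.injEq, true_and]; omega)

end Words

/-! ### Partial derivatives of smooth functions of `(x, t)` -/

/-- `∂_x a`. -/
def px (a : ℝ → ℝ → ℂ) (x t : ℝ) : ℂ := deriv (fun y => a y t) x

/-- `∂_t a`. -/
def pt (a : ℝ → ℝ → ℂ) (x t : ℝ) : ℂ := deriv (fun τ => a x τ) t

/-- Joint smoothness of a function of `(x, t)`. -/
def IsSmooth (a : ℝ → ℝ → ℂ) : Prop := ContDiff ℝ ∞ fun p : ℝ × ℝ => a p.1 p.2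

lemma hasDerivAt_prodMk_left (x t : ℝ) : HasDerivAt (fun y : ℝ => (y, t)) ((1 : ℝ), (0 : ℝ)) x :=
  (hasDerivAt_id x).prodMk (hasDerivAt_const x t)

lemma hasDerivAt_prodMk_right (x t : ℝ) : HasDerivAt (fun τ : ℝ => (x, τ)) ((0 : ℝ), (1 : ℝ)) t :=
  (hasDerivAt_const t x).prodMk (hasDerivAt_id t)

namespace IsSmooth

variable {a b : ℝ → ℝ → ℂ}

lemma differentiable (ha : IsSmooth a) : Differentiable ℝ fun p : ℝ × ℝ => a p.1 p.2 :=
  ContDiff.differentiable ha (by simp)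

lemma px_eq_fderiv (ha : IsSmooth a) (x t : ℝ) :
    px a x t = fderiv ℝ (fun p : ℝ × ℝ => a p.1 p.2) (x, t) (1, 0) :=
  (HasFDerivAt.comp_hasDerivAt (l := fun p : ℝ × ℝ => a p.1 p.2) x
    (ha.differentiable (x, t)).hasFDerivAt (hasDerivAt_prodMk_left x t)).deriv

lemma pt_eq_fderiv (ha : IsSmooth a) (x t : ℝ) :
    pt a x t = fderiv ℝ (fun p : ℝ × ℝ => a p.1 p.2) (x, t) (0, 1) :=
  (HasFDerivAt.comp_hasDerivAt (l := fun p : ℝ × ℝ => a p.1 p.2) t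
    (ha.differentiable (x, t)).hasFDerivAt (hasDerivAt_prodMk_right x t)).deriv

lemma hasDerivAt_px (ha : IsSmooth a) (x t : ℝ) :
    HasDerivAt (fun y => a y t) (px a x t) x :=
  (HasFDerivAt.comp_hasDerivAt (l := fun p : ℝ × ℝ => a p.1 p.2) x
    (ha.differentiable (x, t)).hasFDerivAt
    (hasDerivAt_prodMk_left x t)).differentiableAt.hasDerivAt

lemma hasDerivAt_pt (ha : IsSmooth a) (x t : ℝ) :
    HasDerivAt (fun τ => a x τ) (pt a x t) t :=
  (HasFDerivAt.comp_hasDerivAt (l := fun p : ℝ × ℝ => a p.1 p.2) t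
    (ha.differentiable (x, t)).hasFDerivAt
    (hasDerivAt_prodMk_right x t)).differentiableAt.hasDerivAt

lemma px_isSmooth (ha : IsSmooth a) : IsSmooth (px a) := by
  have h : ContDiff ℝ ∞ (fderiv ℝ (fun p : ℝ × ℝ => a p.1 p.2)) :=
    ContDiff.fderiv_right ha (by simp)
  unfold IsSmooth
  simp only [ha.px_eq_fderiv]
  exact h.clm_apply contDiff_const

lemma pt_isSmooth (ha : IsSmooth a) : IsSmooth (pt a) := by
  have h : ContDiff ℝ ∞ (fderiv ℝ (fun p : ℝ × ℝ => a p.1 p.2)) :=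
    ContDiff.fderiv_right ha (by simp)
  unfold IsSmooth
  simp only [ha.pt_eq_fderiv]
  exact h.clm_apply contDiff_const

lemma pt_px (ha : IsSmooth a) (x t : ℝ) : pt (px a) x t = px (pt a) x t := by
  have h : Differentiable ℝ (fderiv ℝ (fun p : ℝ × ℝ => a p.1 p.2)) :=
    (ContDiff.fderiv_right (m := ∞) ha (by simp)).differentiable (by simp)
  have hs : IsSymmSndFDerivAt ℝ (fun p : ℝ × ℝ => a p.1 p.2) (x, t) :=
    (ContDiff.contDiffAt ha).isSymmSndFDerivAt (by simp [ENat.LEInfty.out])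
  have h1 : pt (px a) x t
      = fderiv ℝ (fderiv ℝ (fun p : ℝ × ℝ => a p.1 p.2)) (x, t) (0, 1) (1, 0) := by
    rw [ha.px_isSmooth.pt_eq_fderiv]
    simp only [ha.px_eq_fderiv]
    rw [fderiv_clm_apply (h _) (by fun_prop)]
    simp
  have h2 : px (pt a) x t
      = fderiv ℝ (fderiv ℝ (fun p : ℝ × ℝ => a p.1 p.2)) (x, t) (1, 0) (0, 1) := by
    rw [ha.pt_isSmooth.px_eq_fderiv]
    simp only [ha.pt_eq_fderiv]
    rw [fderiv_clm_apply (h _) (by fun_prop)]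
    simp
  rw [h1, h2]
  exact hs.eq _ _

lemma star (ha : IsSmooth a) : IsSmooth fun x t => conj (a x t) :=
  Complex.conjCLE.contDiff.comp (g := Complex.conjCLE) ha

lemma const_mul (c : ℂ) (ha : IsSmooth a) : IsSmooth fun x t => c * a x t :=
  contDiff_const.mul ha

end IsSmooth

lemma px_const_mul (c : ℂ) {a : ℝ → ℝ → ℂ} (x t : ℝ) :
    px (fun x t => c * a x t) x t = c * px a x t := by
  simp [px]

lemma pt_const_mul (c : ℂ) {a : ℝ → ℝ → ℂ} (x t : ℝ) :
    pt (fun x t => c * a x t) x t = c * pt a x t := by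
  simp [pt]

lemma hirota_one_zero {a b : ℝ → ℝ → ℂ} (ha : IsSmooth a) (hb : IsSmooth b) (x t : ℝ) :
    hirota 1 0 a b x t = px a x t * b x t - a x t * px b x t := by
  simp only [hirota, Function.iterate_one, Function.iterate_zero, id, dxDiff]
  rw [((ha.hasDerivAt_px x t).mul_const _).deriv, ((hb.hasDerivAt_px x t).const_mul _).deriv]

lemma dtDiff_mul {a b : ℝ → ℝ → ℂ} (ha : IsSmooth a) (hb : IsSmooth b) (x t x' t' : ℝ) :
    dtDiff (fun x t x' t' => a x t * b x' t') x t x' t'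
      = pt a x t * b x' t' - a x t * pt b x' t' := by
  rw [dtDiff, ((ha.hasDerivAt_pt x t).mul_const _).deriv,
    ((hb.hasDerivAt_pt x' t').const_mul _).deriv]

lemma hirota_zero_one {a b : ℝ → ℝ → ℂ} (ha : IsSmooth a) (hb : IsSmooth b) (x t : ℝ) :
    hirota 0 1 a b x t = pt a x t * b x t - a x t * pt b x t := by
  simp only [hirota, Function.iterate_one, Function.iterate_zero, id]
  exact dtDiff_mul ha hb x t x t

lemma hirota_one_one {a b : ℝ → ℝ → ℂ} (ha : IsSmooth a) (hb : IsSmooth b) (x t : ℝ) :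
    hirota 1 1 a b x t = px (pt a) x t * b x t - px a x t * pt b x t
      - pt a x t * px b x t + a x t * px (pt b) x t := by
  simp only [hirota, Function.iterate_one, dxDiff, dtDiff_mul ha hb]
  rw [(((ha.pt_isSmooth.hasDerivAt_px x t).mul_const _).fun_sub
      ((ha.hasDerivAt_px x t).mul_const _)).deriv,
    (((hb.hasDerivAt_px x t).const_mul _).fun_sub
      ((hb.pt_isSmooth.hasDerivAt_px x t).const_mul _)).deriv]
  ring

lemma pt_eq_of_hasDerivAt {a a' : ℝ → ℝ → ℂ}
    (h : ∀ x t, HasDerivAt (fun τ => a x τ) (a' x t) t) : pt a = a' := by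
  funext x t; exact (h x t).deriv

lemma px_eq_of_hasDerivAt {a a' : ℝ → ℝ → ℂ}
    (h : ∀ x t, HasDerivAt (fun y => a y t) (a' x t) x) : px a = a' := by
  funext x t; exact (h x t).deriv

/-! ### Bilinear identities for double Wronskians -/

section Bilinear

variable {N : ℕ} (hN : 1 ≤ N)
variable {B : Matrix (Fin (2 * N)) (Fin (2 * N)) ℂ} {Y : Bool → ℝ → ℝ → Fin (2 * N) → ℂ}

lemma IsFlow.isSmooth_wordDet (h : IsFlow B Y) (w : Fin (2 * N) → Bool × ℤ) :
    IsSmooth (wordDet B Y w) :=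
  h.contDiff_wordDet w

lemma wordDet_psiWord_phi_one (x t : ℝ) :
    wordDet B Y (psiWord hN (true, 1)) x t = 0 :=
  wordDet_eq_zero (i := posFirst hN) (j := posPsi hN)
    (by rw [psiWord_posFirst, psiWord_posPsi]) (posFirst_ne_posPsi hN) x t

lemma wordDet_plucker_last (a b e : Bool × ℤ) (x t : ℝ) :
    wordDet B Y (psiWord hN b) x t * wordDet B Y (lastWord hN e a) x t
      = wordDet B Y (lastWord hN e b) x t * wordDet B Y (psiWord hN a) x t
        - wordDet B Y (psiWord hN e) x t * wordDet B Y (lastWord hN a b) x t := by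
  have h := wordDet_plucker (B := B) (Y := Y) (psiWord hN b) (posLast_ne_posPsi hN) e a x t
  simpa only [update_psiWord_posLast, update_psiWord_posPsi, update_lastWord_posPsi] using h

lemma wordDet_plucker_first (a b d : Bool × ℤ) (x t : ℝ) :
    wordDet B Y (psiWord hN b) x t * wordDet B Y (firstWord hN a d) x t
      = wordDet B Y (firstWord hN a b) x t * wordDet B Y (psiWord hN d) x t
        - wordDet B Y (psiWord hN a) x t * wordDet B Y (firstWord hN d b) x t := by
  have h := wordDet_plucker (B := B) (Y := Y) (psiWord hN b) (posFirst_ne_posPsi hN) a d x t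
  simpa only [update_psiWord_posFirst, update_psiWord_posPsi, update_firstWord_posPsi] using h

/-- The bilinear identity `D_x D_t g·f + g f = 0`. -/
lemma IsFlow.bilinear_first (h : IsFlow B Y) {f g : ℝ → ℝ → ℂ}
    (hf : f = wordDet B Y (psiWord hN (false, 0))) (hg : g = wordDet B Y (psiWord hN (true, 0)))
    (x t : ℝ) :
    px (pt g) x t * f x t - px g x t * pt f x t - pt g x t * px f x t + g x t * px (pt f) x t
      + g x t * f x t = 0 := by
  have hfx := px_eq_of_hasDerivAt fun y τ => h.hasDerivAt_psiWord_psi_fst hN 0 y τ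
  have hgx := px_eq_of_hasDerivAt fun y τ => h.hasDerivAt_psiWord_phi_fst hN 0 y τ
  have hft := pt_eq_of_hasDerivAt fun y τ => h.hasDerivAt_psiWord_psi_zero_snd hN y τ
  have hgt := pt_eq_of_hasDerivAt fun y τ => h.hasDerivAt_psiWord_phi_zero_snd hN y τ
  have hfxt := px_eq_of_hasDerivAt fun y τ => (((h.hasDerivAt_psiWord_psi_fst hN 0 y τ).const_mul
    B⁻¹.trace).fun_add ((h.hasDerivAt_psiWord_psi_fst hN (-1) y τ).const_mul 2)).const_mul
      (-(1 / 4) : ℂ)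
  have hgxt := px_eq_of_hasDerivAt fun y τ => (((h.hasDerivAt_psiWord_phi_fst hN 0 y τ).const_mul
    B⁻¹.trace).fun_neg.fun_add ((h.hasDerivAt_psiWord_phi_fst hN (-1) y τ).const_mul 2)).const_mul
      (-(1 / 4) : ℂ)
  rw [hf, hg, hft, hgt, hfxt, hgxt, hfx, hgx]
  simp only [zero_add, neg_add_cancel, wordDet_psiWord_phi_one]
  -- The traces of B cancel, but those of B⁻¹ enter f_t and g_t with opposite signs. After the three
  -- Plücker relations all that remains has the common factor with φ_{N+1} in place of ψ_0, and the
  -- trace identity `p4` annihilates it.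
  have p1 := wordDet_plucker_last (B := B) (Y := Y) hN (true, -1) (false, 0) (true, N + 1) x t
  have p2 := wordDet_plucker_last (B := B) (Y := Y) hN (true, 0) (false, -1) (true, N + 1) x t
  have p3 := wordDet_plucker_last (B := B) (Y := Y) hN (true, 0) (false, 0) (true, N + 1) x t
  have p4 := h.trace_inv_mul_lastWord hN x t
  linear_combination -p1 + p2 + B⁻¹.trace * p3
    - wordDet B Y (psiWord hN (true, N + 1)) x t * p4

/-- Both t-derivatives are expanded over φ, so their trace terms cancel and a single Plücker
relation is left. -/
lemma IsFlow.bilinear_third (h : IsFlow B Y) {f g F G : ℝ → ℝ → ℂ}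
    (hf : f = wordDet B Y (psiWord hN (false, 0))) (hg : g = wordDet B Y (psiWord hN (true, 0)))
    (hF : F = wordDet B Y (psiWord hN (false, N)))
    (hG : G = wordDet B Y (firstWord hN (false, N) (false, 0))) (x t : ℝ) :
    pt f x t * F x t - f x t * pt F x t = -(1 / 2) * (g x t * G x t) := by
  have hft := pt_eq_of_hasDerivAt fun y τ => h.hasDerivAt_psiWord_psi_snd hN 0 y τ
  have hFt := pt_eq_of_hasDerivAt fun y τ => h.hasDerivAt_psiWord_psi_snd hN N y τ
  have p := wordDet_plucker_first (B := B) (Y := Y) hN (true, 0) (false, 0) (false, N) x t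
  rw [hf, hg, hF, hG, hft, hFt]
  linear_combination (1 / 2) * p

/-- The traces of B⁻¹ cancel as before. Each x-derivative here contributes tr B times the old word
plus twice the word with ψ_N raised, so the Plücker relation is used once with ψ_N and once with
ψ_{N+1}. -/
lemma IsFlow.bilinear_second (h : IsFlow B Y) {f g F G : ℝ → ℝ → ℂ}
    (hf : f = wordDet B Y (psiWord hN (false, 0))) (hg : g = wordDet B Y (psiWord hN (true, 0)))
    (hF : F = wordDet B Y (psiWord hN (false, N)))
    (hG : G = wordDet B Y (firstWord hN (false, N) (false, 0))) (x t : ℝ) :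
    f x t * px (pt F) x t - pt f x t * px F x t = 1 / 2 * (g x t * px G x t) := by
  have hFx0 (y τ : ℝ) := h.hasDerivAt_firstWord_fst hN 1 y τ
  simp only [firstWord_phi_one] at hFx0
  have hFx := px_eq_of_hasDerivAt hFx0
  have hft := pt_eq_of_hasDerivAt fun y τ => h.hasDerivAt_psiWord_psi_snd hN 0 y τ
  have hFt := pt_eq_of_hasDerivAt fun y τ => h.hasDerivAt_psiWord_psi_snd hN N y τ
  have hFxt := px_eq_of_hasDerivAt fun y τ => (((hFx0 y τ).const_mul
    B⁻¹.trace).fun_neg.fun_add ((h.hasDerivAt_firstWord_fst hN 0 y τ).const_mul 2)).const_mul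
      (-(1 / 4) : ℂ)
  have hGx := px_eq_of_hasDerivAt fun y τ => h.hasDerivAt_firstWord_psi_fst hN y τ
  have p := wordDet_plucker_first (B := B) (Y := Y) hN (true, 0) (false, 0) (false, N) x t
  have p' := wordDet_plucker_first (B := B) (Y := Y) hN (true, 0) (false, 0) (false, N + 1) x t
  rw [hf, hg, hF, hG, hft, hFt, hFxt, hFx, hGx]
  linear_combination -(1 / 2) * B.trace * p - p'

end Bilinear

/-! ### The vectors `φ` and `ψ` -/

section Exponential

attribute [local instance] Matrix.linftyOpNormedRing Matrix.linftyOpNormedAlgebra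

variable {n : ℕ}

lemma matrix_hasDerivAt_exp_smul (M : Matrix (Fin n) (Fin n) ℂ) (x : ℝ) :
    HasDerivAt (fun y : ℝ => NormedSpace.exp (y • M)) (M * NormedSpace.exp (x • M)) x :=
  hasDerivAt_exp_smul_const' M x

lemma matrix_contDiff_exp_smul (M : Matrix (Fin n) (Fin n) ℂ) :
    ContDiff ℝ ∞ fun y : ℝ => NormedSpace.exp (y • M) := by
  have h : ContDiff ℝ ∞ (NormedSpace.exp : Matrix (Fin n) (Fin n) ℂ → _) :=
    AnalyticOnNhd.contDiff fun x _ => NormedSpace.exp_analytic x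
  exact h.comp (contDiff_id.smul contDiff_const)

lemma hasDerivAt_mulVec_const {M : ℝ → Matrix (Fin n) (Fin n) ℂ} {M' : Matrix (Fin n) (Fin n) ℂ}
    {x : ℝ} (h : HasDerivAt M M' x) (v : Fin n → ℂ) :
    HasDerivAt (fun y => M y *ᵥ v) (M' *ᵥ v) x := by
  let L : Matrix (Fin n) (Fin n) ℂ →ₗ[ℝ] (Fin n → ℂ) :=
    { toFun := fun M => M *ᵥ v
      map_add' := fun M M' => Matrix.add_mulVec M M' v
      map_smul' := fun c M => Matrix.smul_mulVec c M v }
  exact L.toContinuousLinearMap.hasFDerivAt.comp_hasDerivAt x h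

lemma hasDerivAt_exp_smul_mulVec (M : Matrix (Fin n) (Fin n) ℂ) (v : Fin n → ℂ) (x : ℝ) :
    HasDerivAt (fun y : ℝ => NormedSpace.exp (y • M) *ᵥ v)
      (M *ᵥ (NormedSpace.exp (x • M) *ᵥ v)) x := by
  rw [Matrix.mulVec_mulVec]
  exact hasDerivAt_mulVec_const (matrix_hasDerivAt_exp_smul M x) v

lemma contDiff_exp_smul_apply (M : Matrix (Fin n) (Fin n) ℂ) (i j : Fin n) :
    ContDiff ℝ ∞ fun y : ℝ => (NormedSpace.exp (y • M) : Matrix (Fin n) (Fin n) ℂ) i j := by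
  let L : Matrix (Fin n) (Fin n) ℂ →ₗ[ℝ] ℂ :=
    { toFun := fun M => M i j
      map_add' := fun _ _ => rfl
      map_smul' := fun _ _ => rfl }
  exact L.toContinuousLinearMap.contDiff.comp (matrix_contDiff_exp_smul M)

lemma exp_add_smul (M M' : Matrix (Fin n) (Fin n) ℂ) (h : Commute M M') (x t : ℝ) :
    NormedSpace.exp (x • M + t • M') = NormedSpace.exp (x • M) * NormedSpace.exp (t • M') :=
  Matrix.exp_add_of_commute _ _ ((h.smul_left x).smul_right t)

end Exponential

/-! ### Evolution and conjugation symmetry of φ and ψ -/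

section Solution

variable {n : ℕ} {A T : Matrix (Fin n) (Fin n) ℂ} {C : Fin n → ℂ} {δ : ℝ}

/-- The matrix `(i/2) A²` of the `x`-evolution of `φ`. -/
def evolB (A : Matrix (Fin n) (Fin n) ℂ) : Matrix (Fin n) (Fin n) ℂ := (Complex.I / 2) • A ^ 2

lemma isUnit_det_evolB (hA : IsUnit A) : IsUnit (evolB A).det := by
  rw [evolB, Matrix.det_smul, Matrix.det_pow]
  have h1 : A.det ≠ 0 := ((Matrix.isUnit_iff_isUnit_det A).1 hA).ne_zero
  have h2 : Complex.I / 2 ≠ 0 := by simp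
  exact isUnit_iff_ne_zero.2 (mul_ne_zero (pow_ne_zero _ h2) (pow_ne_zero _ h1))

lemma evolB_inv (hA : IsUnit A) : (evolB A)⁻¹ = (-2 * Complex.I) • A⁻¹ ^ 2 := by
  have h1 : IsUnit A.det := (Matrix.isUnit_iff_isUnit_det A).1 hA
  refine Matrix.inv_eq_right_inv ?_
  have h2 : A ^ 2 * A⁻¹ ^ 2 = 1 := by
    rw [pow_two, pow_two, Matrix.mul_assoc, ← Matrix.mul_assoc A A⁻¹, Matrix.mul_nonsing_inv _ h1,
      Matrix.one_mul, Matrix.mul_nonsing_inv _ h1]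
  rw [evolB, Matrix.smul_mul, Matrix.mul_smul, h2, smul_smul]
  have h3 : Complex.I / 2 * (-2 * Complex.I) = 1 := by
    linear_combination -Complex.I_mul_I
  rw [h3, one_smul]

/-- The origin of the factor -1/4: B⁻¹ = -2iA⁻². -/
lemma quarter_smul_evolB_inv (hA : IsUnit A) :
    (-(1 / 4) : ℂ) • (evolB A)⁻¹ = (Complex.I / 2) • A⁻¹ ^ 2 := by
  rw [evolB_inv hA, smul_smul]; congr 1; ring

lemma commute_evolB_inv (hA : IsUnit A) : Commute (evolB A) (evolB A)⁻¹ := by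
  have h := isUnit_det_evolB hA
  rw [Commute, SemiconjBy, Matrix.mul_nonsing_inv _ h, Matrix.nonsing_inv_mul _ h]

lemma phi_eq (hA : IsUnit A) (x t : ℝ) :
    phi A C x t = NormedSpace.exp (x • evolB A)
      *ᵥ (NormedSpace.exp (t • ((-(1 / 4) : ℂ) • (evolB A)⁻¹)) *ᵥ C) := by
  rw [Matrix.mulVec_mulVec, ← exp_add_smul _ _ ((commute_evolB_inv hA).smul_right _),
    quarter_smul_evolB_inv hA, phi, evolB]
  congr 2
  ext i j
  simp only [Matrix.add_apply, Matrix.smul_apply, smul_eq_mul, Complex.real_smul]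
  ring

/-- The commuting factors are exchanged so that the t-exponential is outermost and can be
differentiated. -/
lemma phi_eq' (hA : IsUnit A) (x t : ℝ) :
    phi A C x t = NormedSpace.exp (t • ((-(1 / 4) : ℂ) • (evolB A)⁻¹))
      *ᵥ (NormedSpace.exp (x • evolB A) *ᵥ C) := by
  rw [phi_eq hA, Matrix.mulVec_mulVec, Matrix.mulVec_mulVec,
    ← exp_add_smul _ _ ((commute_evolB_inv hA).smul_right _),
    ← exp_add_smul _ _ ((commute_evolB_inv hA).smul_right _).symm, add_comm]

lemma hasDerivAt_phi_fst (hA : IsUnit A) (x t : ℝ) :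
    HasDerivAt (fun y => phi A C y t) (evolB A *ᵥ phi A C x t) x := by
  simp only [phi_eq hA]
  exact hasDerivAt_exp_smul_mulVec _ _ x

lemma hasDerivAt_phi_snd (hA : IsUnit A) (x t : ℝ) :
    HasDerivAt (fun τ => phi A C x τ) ((-(1 / 4) : ℂ) • ((evolB A)⁻¹ *ᵥ phi A C x t)) t := by
  simp only [phi_eq' hA]
  rw [← Matrix.smul_mulVec]
  exact hasDerivAt_exp_smul_mulVec _ _ t

lemma contDiff_phi (hA : IsUnit A) : ContDiff ℝ ∞ fun p : ℝ × ℝ => phi A C p.1 p.2 := by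
  refine contDiff_pi.2 fun k => ?_
  simp only [phi_eq hA, Matrix.mulVec, dotProduct]
  exact ContDiff.sum fun i _ => ((contDiff_exp_smul_apply _ k i).comp contDiff_fst).mul
    (ContDiff.sum fun j _ => ((contDiff_exp_smul_apply _ i j).comp contDiff_snd).mul contDiff_const)

lemma conj_mulVec (M : Matrix (Fin n) (Fin n) ℂ) (v : Fin n → ℂ) :
    (fun k => conj ((M *ᵥ v) k)) = conjMat M *ᵥ fun k => conj (v k) := by
  funext k; exact RingHom.map_mulVec (starRingEnd ℂ) M v k

lemma conjMat_mul (M M' : Matrix (Fin n) (Fin n) ℂ) :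
    conjMat (M * M') = conjMat M * conjMat M' :=
  Matrix.map_mul (f := starRingEnd ℂ)

lemma conjMat_one : conjMat (1 : Matrix (Fin n) (Fin n) ℂ) = 1 :=
  (starRingEnd ℂ).mapMatrix.map_one

/-- AT intertwines (A*)² with A², while conjugating i/2 flips the sign; hence ψ evolves backwards.
-/
lemma mul_conjMat_evolB (hAT : A * T = T * conjMat A) :
    A * T * conjMat (evolB A) = -(evolB A * (A * T)) := by
  have h : conjMat (evolB A) = (-(Complex.I / 2)) • (conjMat A * conjMat A) := by
    rw [← conjMat_mul, ← pow_two]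
    ext i j
    simp [conjMat, evolB, map_ofNat, neg_div]
  have h2 : A * T * (conjMat A * conjMat A) = A ^ 2 * (A * T) := by
    rw [← Matrix.mul_assoc, Matrix.mul_assoc A T, ← hAT, Matrix.mul_assoc, Matrix.mul_assoc A T,
      ← hAT, pow_two, Matrix.mul_assoc]
  rw [h, Matrix.mul_smul, h2, evolB, Matrix.smul_mul, neg_smul]

lemma mul_conjMat_evolB_inv (hA : IsUnit A) (hAT : A * T = T * conjMat A) :
    A * T * conjMat (evolB A)⁻¹ = -((evolB A)⁻¹ * (A * T)) := by
  have hB := isUnit_det_evolB hA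
  have h1 : conjMat (evolB A) * conjMat (evolB A)⁻¹ = 1 := by
    rw [← conjMat_mul, Matrix.mul_nonsing_inv _ hB, conjMat_one]
  have h2 : A * T = -((evolB A)⁻¹ * (A * T * conjMat (evolB A))) := by
    rw [mul_conjMat_evolB hAT, Matrix.mul_neg, neg_neg, ← Matrix.mul_assoc,
      Matrix.nonsing_inv_mul _ hB, Matrix.one_mul]
  conv_lhs => rw [h2]
  rw [Matrix.neg_mul, Matrix.mul_assoc, Matrix.mul_assoc (A * T), h1, Matrix.mul_one]

lemma hasDerivAt_conj {v : ℝ → Fin n → ℂ} {v' : Fin n → ℂ} {x : ℝ} (h : HasDerivAt v v' x) :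
    HasDerivAt (fun y k => conj (v y k)) (fun k => conj (v' k)) x := by
  rw [hasDerivAt_pi] at h ⊢
  exact fun k => (h k).star

/-- The pair `φ, ψ`, indexed by `true, false`. -/
def pair (A T : Matrix (Fin n) (Fin n) ℂ) (C : Fin n → ℂ) (b : Bool) : ℝ → ℝ → Fin n → ℂ :=
  if b then phi A C else psi A T C

@[simp] lemma pair_true : pair A T C true = phi A C := rfl

@[simp] lemma pair_false : pair A T C false = psi A T C := rfl

lemma isFlow_pair (hA : IsUnit A) (hAT : A * T = T * conjMat A) :
    IsFlow (evolB A) (pair A T C) where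
  isUnit_det := isUnit_det_evolB hA
  hasDerivAt_fst b x t := by
    cases b
    · have h := hasDerivAt_mulVec (A * T) (hasDerivAt_conj (hasDerivAt_phi_fst (C := C) hA x t))
      convert! h using 1
      rw [conj_mulVec, Matrix.mulVec_mulVec, mul_conjMat_evolB hAT]
      simp [psi, Matrix.neg_mulVec]
    · simpa using hasDerivAt_phi_fst (C := C) hA x t
  hasDerivAt_snd b x t := by
    cases b
    · have h := hasDerivAt_mulVec (A * T) (hasDerivAt_conj (hasDerivAt_phi_snd (C := C) hA x t))
      convert! h using 1
      have h2 : (fun k => conj (((-(1 / 4) : ℂ) • ((evolB A)⁻¹ *ᵥ phi A C x t)) k))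
          = (-(1 / 4) : ℂ) • fun k => conj (((evolB A)⁻¹ *ᵥ phi A C x t) k) := by
        ext k; simp [map_ofNat]
      rw [h2, conj_mulVec, Matrix.mulVec_smul, Matrix.mulVec_mulVec,
        mul_conjMat_evolB_inv hA hAT]
      simp [psi, Matrix.neg_mulVec]
    · simpa using hasDerivAt_phi_snd (C := C) hA x t
  contDiff b := by
    cases b
    · refine contDiff_pi.2 fun k => ?_
      simp only [pair_false, psi, Matrix.mulVec, dotProduct]
      exact ContDiff.sum fun j _ => contDiff_const.mul
        (Complex.conjCLE.contDiff.comp (contDiff_pi.1 (contDiff_phi (C := C) hA) j))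
    · exact contDiff_phi hA

/-- The matrix `(A T)⁻¹` turns the columns of `φ` and `ψ` into each other's conjugates. -/
lemma conj_col_true (hA : IsUnit A) (hT : IsUnit T) (hAT : A * T = T * conjMat A) (m : ℕ)
    (x t : ℝ) :
    (fun k => conj (col (evolB A) (pair A T C) (true, m) x t k))
      = (A * T)⁻¹ *ᵥ col (evolB A) (pair A T C) (false, m) x t := by
  have hU : IsUnit (A * T).det := (Matrix.isUnit_iff_isUnit_det _).1 (hA.mul hT)
  have hflow := isFlow_pair (C := C) hA hAT
  -- After multiplication by AT, the case m = 0 is the definition of ψ, and each further derivative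
  -- passes through the intertwining relation.
  suffices h : (A * T) *ᵥ (fun k => conj (col (evolB A) (pair A T C) (true, m) x t k))
      = col (evolB A) (pair A T C) (false, m) x t by
    rw [← h, Matrix.mulVec_mulVec, Matrix.nonsing_inv_mul _ hU, Matrix.one_mulVec]
  induction m with
  | zero => simp [col, psi]
  | succ m ih =>
    have h1 := hflow.mulVec_col (true, (m : ℤ)) x t
    have h2 := hflow.mulVec_col (false, (m : ℤ)) x t
    simp only [sgn_true, one_smul, up_mk, sgn_false] at h1 h2
    push_cast
    rw [← h1, conj_mulVec, Matrix.mulVec_mulVec, mul_conjMat_evolB hAT, Matrix.neg_mulVec,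
      ← Matrix.mulVec_mulVec, ih, h2]
    simp

/-- AT(AT)* = A(TA*)T* = A²TT* = δA², and A² = -2iB. -/
lemma conjMat_mul_eq (hA : IsUnit A) (hT : IsUnit T) (hAT : A * T = T * conjMat A)
    (hTT : T * conjMat T = (δ : ℂ) • (1 : Matrix (Fin n) (Fin n) ℂ)) :
    conjMat (A * T) = (-2 * Complex.I * δ) • ((A * T)⁻¹ * evolB A) := by
  have hU : IsUnit (A * T).det := (Matrix.isUnit_iff_isUnit_det _).1 (hA.mul hT)
  have h : A * T * conjMat (A * T) = (δ : ℂ) • A ^ 2 := by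
    rw [conjMat_mul, ← Matrix.mul_assoc, Matrix.mul_assoc A T, ← hAT, Matrix.mul_assoc,
      Matrix.mul_assoc A T, hTT, Matrix.mul_smul, Matrix.mul_smul, Matrix.mul_one, pow_two]
  have h2 : conjMat (A * T) = (A * T)⁻¹ * ((δ : ℂ) • A ^ 2) := by
    rw [← h, ← Matrix.mul_assoc, Matrix.nonsing_inv_mul _ hU, Matrix.one_mul]
  rw [h2, evolB, Matrix.mul_smul, Matrix.mul_smul, smul_smul]
  congr 1
  linear_combination (δ : ℂ) * Complex.I_mul_I

/-- Conjugating ψ_m = AT φ_m* gives (AT)*φ_m, and the factor B inside (AT)* raises the index to m +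
1. -/
lemma conj_col_false (hA : IsUnit A) (hT : IsUnit T) (hAT : A * T = T * conjMat A)
    (hTT : T * conjMat T = (δ : ℂ) • (1 : Matrix (Fin n) (Fin n) ℂ)) (m : ℕ) (x t : ℝ) :
    (fun k => conj (col (evolB A) (pair A T C) (false, m) x t k))
      = (-2 * Complex.I * δ) •
        ((A * T)⁻¹ *ᵥ col (evolB A) (pair A T C) (true, (m : ℤ) + 1) x t) := by
  have hU : IsUnit (A * T).det := (Matrix.isUnit_iff_isUnit_det _).1 (hA.mul hT)
  have h1 : col (evolB A) (pair A T C) (false, m) x t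
      = (A * T) *ᵥ fun k => conj (col (evolB A) (pair A T C) (true, m) x t k) := by
    rw [conj_col_true hA hT hAT, Matrix.mulVec_mulVec, Matrix.mul_nonsing_inv _ hU,
      Matrix.one_mulVec]
  have h2 := (isFlow_pair (C := C) hA hAT).mulVec_col (true, (m : ℤ)) x t
  simp only [sgn_true, one_smul, up_mk] at h2
  rw [h1, conj_mulVec, conjMat_mul_eq hA hT hAT hTT, ← h2, Matrix.mulVec_mulVec,
    Matrix.smul_mulVec]
  simp

end Solution

/-! ### The double Wronskians as words -/

section Rearrangement

variable {N : ℕ}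

lemma coe_finRotate_pow (n k : ℕ) (j : Fin n) :
    (((finRotate n ^ k) j : Fin n) : ℕ) = ((j : ℕ) + k) % n := by
  induction k with
  | zero => simp [Nat.mod_eq_of_lt j.2]
  | succ k ih =>
    have : NeZero n := j.neZero
    rw [pow_succ', Equiv.Perm.mul_apply, finRotate_apply, Fin.val_add, ih, Fin.val_one',
      ← Nat.add_mod, ← add_assoc]

lemma sign_finRotate_pow (hN : 1 ≤ N) :
    ((Equiv.Perm.sign (finRotate (2 * N) ^ N) : ℤ) : ℂ) = (-1) ^ N := by
  have h : Odd (2 * N - 1) := ⟨N - 1, by omega⟩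
  rw [map_pow, sign_finRotate, h.neg_one_pow]
  push_cast; rfl

lemma sign_cycleRange_cast {n : ℕ} (i : Fin n) :
    ((Equiv.Perm.sign (Fin.cycleRange i) : ℤ) : ℂ) = (-1) ^ (i : ℕ) := by
  rw [Fin.sign_cycleRange]; push_cast; rfl

lemma coe_cycleRange {n : ℕ} (i j : Fin n) :
    ((Fin.cycleRange i j : Fin n) : ℕ)
      = if (j : ℕ) < i then (j : ℕ) + 1 else if (j : ℕ) = i then 0 else j := by
  have : NeZero n := j.neZero
  split_ifs with h1 h2
  · exact Fin.coe_cycleRange_of_lt h1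
  · rw [Fin.cycleRange_of_eq (Fin.ext h2)]; simp
  · rw [Fin.cycleRange_of_gt (Fin.lt_def.2 (by omega))]

lemma prod_ite_lt_one {n : ℕ} (p : ℕ) (c : ℂ) :
    ∏ j : Fin n, (if (j : ℕ) < p then 1 else c) = c ^ (n - p) := by
  induction n with
  | zero => simp
  | succ n ih =>
    rw [Fin.prod_univ_castSucc]
    simp only [Fin.val_castSucc, Fin.val_last, ih]
    split_ifs with h
    · rw [show n - p = 0 by omega, show n + 1 - p = 0 by omega]; simp
    · rw [show n + 1 - p = (n - p) + 1 by omega, pow_succ]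

/-- The word `φ_a ⋯ φ_{a+p-1} ψ_b ψ_{b+1} ⋯`. -/
def blockWord (n p a b : ℕ) (j : Fin n) : Bool × ℤ :=
  if (j : ℕ) < p then (true, ((a + j : ℕ) : ℤ)) else (false, ((b + (j - p) : ℕ) : ℤ))

/-- The word of the complex conjugate of `blockWord n p a b`. -/
def conjWord (n p a b : ℕ) (j : Fin n) : Bool × ℤ :=
  if (j : ℕ) < p then (false, ((a + j : ℕ) : ℤ)) else (true, ((b + (j - p) : ℕ) : ℤ) + 1)

lemma blockWord_f (hN : 1 ≤ N) : blockWord (2 * N) N 1 0 = psiWord hN (false, 0) := by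
  rw [psiWord_psi_zero]
  funext j
  simp only [blockWord, fWord]
  split_ifs
  · simp only [Prod.mk.injEq, true_and]; omega
  · simp only [Prod.mk.injEq, true_and]; omega

/-- φ_0 moves from the front past the N columns φ_1, …, φ_N. -/
lemma blockWord_g_comp (hN : 1 ≤ N) :
    blockWord (2 * N) (N + 1) 0 1 ∘ Fin.cycleRange (posPsi hN) = psiWord hN (true, 0) := by
  funext j
  simp only [Function.comp_apply, blockWord, coe_cycleRange, psiWord, Function.update_apply,
    fWord, Fin.ext_iff, posPsi]
  split_ifs <;> first
    | contradiction
    | omega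
    | (simp only [Prod.mk.injEq, true_and]; omega)

/-- In ψ_1…ψ_N φ_1…φ_N the two blocks are exchanged by N rotations, and ψ_N is brought to the front
of its block. -/
lemma conjWord_f_eq (hN : 1 ≤ N) :
    conjWord (2 * N) N 1 0
      = (psiWord hN (false, N) ∘ (finRotate (2 * N) ^ N)) ∘ Fin.cycleRange (posLast hN) := by
  funext j
  obtain ⟨j, hj⟩ := j
  simp only [Function.comp_apply, conjWord, psiWord, Function.update_apply,
    fWord, Fin.ext_iff, posPsi, coe_finRotate_pow, coe_cycleRange, posLast]
  rcases lt_trichotomy j (N - 1) with h | h | h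
  · have e : (if j < N - 1 then j + 1 else if j = N - 1 then 0 else j) = j + 1 := by
      split_ifs <;> omega
    rw [e, Nat.mod_eq_of_lt (by omega)]
    split_ifs <;> first
      | contradiction
      | omega
      | (simp only [Prod.mk.injEq, true_and]; omega)
  · have e : (if j < N - 1 then j + 1 else if j = N - 1 then 0 else j) = 0 := by
      split_ifs <;> omega
    rw [e, Nat.mod_eq_of_lt (by omega)]
    split_ifs <;> first
      | contradiction
      | omega
      | (simp only [Prod.mk.injEq, true_and]; omega)
  · have e : (if j < N - 1 then j + 1 else if j = N - 1 then 0 else j) = j := by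
      split_ifs <;> omega
    rw [e, Nat.mod_eq_sub_mod (by omega), Nat.mod_eq_of_lt (by omega)]
    split_ifs <;> first
      | contradiction
      | omega
      | (simp only [Prod.mk.injEq, true_and]; omega)

lemma conjWord_g_comp (hN : 1 ≤ N) :
    conjWord (2 * N) (N + 1) 0 1 ∘ (finRotate (2 * N) ^ N)
      = firstWord hN (false, N) (false, 0) := by
  funext j
  obtain ⟨j, hj⟩ := j
  simp only [Function.comp_apply, conjWord, firstWord, Function.update_apply,
    fWord, Fin.ext_iff, posPsi, posFirst, coe_finRotate_pow]
  rcases lt_or_ge j N with h | h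
  · rw [Nat.mod_eq_of_lt (by omega)]
    split_ifs <;> first
      | contradiction
      | omega
      | (simp only [Prod.mk.injEq, true_and]; omega)
  · rw [Nat.mod_eq_sub_mod (by omega), Nat.mod_eq_of_lt (by omega)]
    split_ifs <;> first
      | contradiction
      | omega
      | (simp only [Prod.mk.injEq, true_and]; omega)

end Rearrangement

/-! ### Double Wronskians and their conjugates as determinants of words -/

section Wronskian

variable {n : ℕ} {A T : Matrix (Fin n) (Fin n) ℂ} {C : Fin n → ℂ} {δ : ℝ}

lemma IsFlow.iteratedDeriv_eq_col {B : Matrix (Fin n) (Fin n) ℂ}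
    {Y : Bool → ℝ → ℝ → Fin n → ℂ} (h : IsFlow B Y) (b : Bool) (m : ℕ) (k : Fin n) (x t : ℝ) :
    iteratedDeriv m (fun y => Y b y t k) x = col B Y (b, m) x t k := by
  induction m generalizing x with
  | zero => simp [col]
  | succ m ih =>
    rw [iteratedDeriv_succ, funext ih]
    have h1 := (hasDerivAt_pi.1 (h.hasDerivAt_col_fst (b, (m : ℤ)) x t) k).deriv
    rw [h1]
    simp

lemma doubleWronskian_eq_wordDet (hA : IsUnit A) (hAT : A * T = T * conjMat A) (p a b : ℕ)
    (x t : ℝ) :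
    doubleWronskian p a b (phi A C) (psi A T C) x t
      = wordDet (evolB A) (pair A T C) (blockWord n p a b) x t := by
  have h := isFlow_pair (C := C) hA hAT
  rw [doubleWronskian, wordDet, colDet]
  congr 1
  ext k j
  simp only [Matrix.of_apply, blockWord]
  split_ifs
  · rw [← h.iteratedDeriv_eq_col true]; rfl
  · rw [← h.iteratedDeriv_eq_col false]; rfl

lemma conj_wordDet_blockWord (hA : IsUnit A) (hT : IsUnit T) (hAT : A * T = T * conjMat A)
    (hTT : T * conjMat T = (δ : ℂ) • (1 : Matrix (Fin n) (Fin n) ℂ)) (p a b : ℕ) (x t : ℝ) :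
    conj (wordDet (evolB A) (pair A T C) (blockWord n p a b) x t)
      = (-2 * Complex.I * δ) ^ (n - p) * (A * T)⁻¹.det
        * wordDet (evolB A) (pair A T C) (conjWord n p a b) x t := by
  have h : ∀ j : Fin n, (fun k => conj (col (evolB A) (pair A T C) (blockWord n p a b j) x t k))
      = (if (j : ℕ) < p then 1 else (-2 * Complex.I * δ)) •
        ((A * T)⁻¹ *ᵥ col (evolB A) (pair A T C) (conjWord n p a b j) x t) := by
    intro j
    rw [blockWord, conjWord]
    split_ifs
    · rw [conj_col_true hA hT hAT, one_smul]
    · rw [conj_col_false hA hT hAT hTT]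
  rw [wordDet, conj_colDet]
  rw [congrArg colDet (funext h), colDet_smul, prod_ite_lt_one, colDet_mulVec, wordDet]
  ring

end Wronskian

/-- The double Wronskians and their conjugates, expressed through four words. -/
lemma exists_wronskian_words {N : ℕ} (hN : 1 ≤ N) {A T : Matrix (Fin (2 * N)) (Fin (2 * N)) ℂ}
    {C : Fin (2 * N) → ℂ} {δ : ℝ} (hA : IsUnit A) (hT : IsUnit T)
    (hAT : A * T = T * conjMat A)
    (hTT : T * conjMat T = (δ : ℂ) • (1 : Matrix (Fin (2 * N)) (Fin (2 * N)) ℂ)) :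
    ∃ ε c c' : ℂ, c = 2 * Complex.I * δ * (ε * c') ∧
      ∀ x t : ℝ,
        wronskF A T C x t = wordDet (evolB A) (pair A T C) (psiWord hN (false, 0)) x t ∧
        wronskG A T C x t = ε * wordDet (evolB A) (pair A T C) (psiWord hN (true, 0)) x t ∧
        conj (wronskF A T C x t)
          = c * wordDet (evolB A) (pair A T C) (psiWord hN (false, N)) x t ∧
        conj (wronskG A T C x t)
          = c' * wordDet (evolB A) (pair A T C) (firstWord hN (false, N) (false, 0)) x t := by
  have hsq : ((-1 : ℂ) ^ N) * (-1) ^ N = 1 := by rw [← mul_pow]; simp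
  -- Each ψ-column yields a factor -2iδ under conjugation: N of them in f, N - 1 in g. Only the
  -- resulting ratio of constants matters later.
  refine ⟨(-1) ^ N, -((-2 * Complex.I * δ) ^ N * (A * T)⁻¹.det),
    (-1) ^ N * ((-2 * Complex.I * δ) ^ (N - 1) * (A * T)⁻¹.det), ?_, fun x t => ⟨?_, ?_, ?_, ?_⟩⟩
  · have h : (-2 * Complex.I * δ) ^ N
        = (-2 * Complex.I * (δ : ℂ)) ^ (N - 1) * (-2 * Complex.I * δ) := by
      rw [← pow_succ, Nat.sub_add_cancel hN]
    rw [h]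
    linear_combination -(2 * Complex.I * (δ : ℂ) * (-2 * Complex.I * (δ : ℂ)) ^ (N - 1)
      * (A * T)⁻¹.det) * hsq
  · rw [wronskF, doubleWronskian_eq_wordDet hA hAT, blockWord_f hN]
  · rw [wronskG, doubleWronskian_eq_wordDet hA hAT, ← blockWord_g_comp hN, wordDet_comp_perm,
      sign_cycleRange_cast, ← mul_assoc]
    change _ = (-1) ^ N * (-1) ^ N * _
    rw [hsq, one_mul]
  · rw [wronskF, doubleWronskian_eq_wordDet hA hAT, conj_wordDet_blockWord hA hT hAT hTT,
      conjWord_f_eq hN, wordDet_comp_perm, wordDet_comp_perm, sign_cycleRange_cast,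
      sign_finRotate_pow hN, show 2 * N - N = N by omega]
    -- N rotations give (-1)^N and the cycle of ψ_N gives (-1)^(N-1).
    have h : (-1 : ℂ) ^ ((posLast hN : Fin (2 * N)) : ℕ) * (-1) ^ N = -1 := by
      rw [← pow_add]
      exact Odd.neg_one_pow ⟨N - 1, by simp only [posLast]; omega⟩
    linear_combination ((-2 * Complex.I * δ) ^ N * (A * T)⁻¹.det
      * wordDet (evolB A) (pair A T C) (psiWord hN (false, N)) x t) * h
  · rw [wronskG, doubleWronskian_eq_wordDet hA hAT, conj_wordDet_blockWord hA hT hAT hTT,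
      ← conjWord_g_comp hN, wordDet_comp_perm, sign_finRotate_pow hN,
      show 2 * N - (N + 1) = N - 1 by omega]
    linear_combination -((-2 * Complex.I * δ) ^ (N - 1) * (A * T)⁻¹.det
      * wordDet (evolB A) (pair A T C) (conjWord (2 * N) (N + 1) 0 1) x t) * hsq

/-! ### From the bilinear equations to the Fokas–Lenells equation -/

/-- Dividing by the value at `t` brings the function near 1, where the principal logarithm is
continuous. -/
lemma exists_isLogBranchNear {r : ℝ → ℂ} {t : ℝ} (hr : ∀ᶠ τ in 𝓝 t, ContinuousAt r τ)
    (h0 : r t ≠ 0) : ∃ L, IsLogBranchNear L r t := by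
  refine ⟨fun τ => Complex.log (r t) + Complex.log (r τ / r t), ?_⟩
  have h1 : ∀ᶠ τ in 𝓝 t, r τ / r t ∈ Complex.slitPlane := by
    refine (hr.self_of_nhds.div_const (r t)).eventually_mem
      (Complex.isOpen_slitPlane.mem_nhds ?_)
    rw [div_self h0]; exact Complex.one_mem_slitPlane
  filter_upwards [hr, h1] with τ hc hs
  refine ⟨continuousAt_const.add ((hc.div_const _).clog hs), ?_⟩
  rw [Complex.exp_add, Complex.exp_log h0, Complex.exp_log (Complex.slitPlane_ne_zero hs),
    mul_div_cancel₀ _ h0]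

/-- By continuity Im(L τ - L t) stays below π in absolute value, so L τ - L t is the principal
logarithm of r τ / r t. -/
lemma IsLogBranchNear.hasDerivAt {L r : ℝ → ℂ} {t : ℝ} {r' : ℂ} (hL : IsLogBranchNear L r t)
    (hr : HasDerivAt r r' t) : HasDerivAt L (r' / r t) t := by
  have hLt := hL.self_of_nhds
  have h0 : r t ≠ 0 := hLt.2 ▸ Complex.exp_ne_zero _
  have hlog : HasDerivAt (fun τ => L t + Complex.log (r τ / r t)) (r' / r t) t := by
    have h1 : r t / r t ∈ Complex.slitPlane := by
      rw [div_self h0]; exact Complex.one_mem_slitPlane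
    have h2 := ((hr.div_const (r t)).clog_real h1).const_add (L t)
    rwa [div_self h0, div_one] at h2
  refine hlog.congr_of_eventuallyEq ?_
  have him : ∀ᶠ τ in 𝓝 t, |(L τ - L t).im| < Real.pi := by
    have hc : ContinuousAt (fun τ => |(L τ - L t).im|) t :=
      (Complex.continuous_im.continuousAt.comp (hLt.1.sub continuousAt_const)).abs
    refine hc.eventually_lt continuousAt_const ?_
    simpa using Real.pi_pos
  filter_upwards [hL, him] with τ hτ hi
  rw [abs_lt] at hi
  rw [← hτ.2, ← hLt.2, ← Complex.exp_sub, Complex.log_exp hi.1 hi.2.le]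
  ring

lemma ofReal_norm_sq (z : ℂ) : ((‖z‖ ^ 2 : ℝ) : ℂ) = z * conj z := by
  rw [Complex.mul_conj, Complex.normSq_eq_norm_sq]

lemma px_conj {a : ℝ → ℝ → ℂ} (ha : IsSmooth a) (x t : ℝ) :
    px (fun x t => conj (a x t)) x t = conj (px a x t) :=
  (ha.hasDerivAt_px x t).star.deriv

lemma pt_conj {a : ℝ → ℝ → ℂ} (ha : IsSmooth a) (x t : ℝ) :
    pt (fun x t => conj (a x t)) x t = conj (pt a x t) :=
  (ha.hasDerivAt_pt x t).star.deriv

section Reduction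

variable {f g : ℝ → ℝ → ℂ} {δ : ℝ}

/-- The first bilinear equation, `D_x D_t g·f + g f = 0`. -/
def BilinearGF (f g : ℝ → ℝ → ℂ) : Prop := ∀ x t, px (pt g) x t * f x t - px g x t * pt f x t
  - pt g x t * px f x t + g x t * px (pt f) x t + g x t * f x t = 0

/-- The equation `D_t f·f* + i δ g g* = 0`. -/
def BilinearT (δ : ℝ) (f g : ℝ → ℝ → ℂ) : Prop := ∀ x t,
  pt f x t * conj (f x t) - f x t * conj (pt f x t)
    + Complex.I * δ * (g x t * conj (g x t)) = 0

/-- The equation `f_{xt} f* - f_x f*_t + i δ g_x g* = 0`. -/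
def BilinearXT (δ : ℝ) (f g : ℝ → ℝ → ℂ) : Prop := ∀ x t,
  px (pt f) x t * conj (f x t) - px f x t * conj (pt f x t)
    + Complex.I * δ * (px g x t * conj (g x t)) = 0

/-- This derivative converts between `BilinearXT` and the Hirota form of the second bilinear
equation. -/
lemma BilinearT.deriv_fst (h : BilinearT δ f g) (hf : IsSmooth f) (hg : IsSmooth g) (x t : ℝ) :
    px (pt f) x t * conj (f x t) + pt f x t * conj (px f x t) - px f x t * conj (pt f x t)
      - f x t * conj (px (pt f) x t)
      + Complex.I * δ * (px g x t * conj (g x t) + g x t * conj (px g x t)) = 0 := by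
  have hf1 := hf.hasDerivAt_px x t
  have hft := hf.pt_isSmooth.hasDerivAt_px x t
  have hg1 := hg.hasDerivAt_px x t
  have h1 := ((hft.mul hf1.star).fun_sub (hf1.mul hft.star)).fun_add
    ((hg1.mul hg1.star).const_mul (Complex.I * δ))
  have h2 : HasDerivAt (fun y => pt f y t * conj (f y t) - f y t * conj (pt f y t)
      + Complex.I * δ * (g y t * conj (g y t))) 0 x := by
    simp only [h _ t]
    exact hasDerivAt_const x 0
  have h3 := h1.unique h2
  simp only [← starRingEnd_apply] at h3
  linear_combination h3

lemma isFLSolutionOn_of_bilinear (hf : IsSmooth f) (hg : IsSmooth g) (h1 : BilinearGF f g)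
    (h2 : BilinearXT δ f g) (h3 : BilinearT δ f g) :
    IsFLSolutionOn δ {p : ℝ × ℝ | f p.1 p.2 ≠ 0} fun x t => g x t / f x t := by
  refine ⟨isOpen_ne_fun (ContDiff.continuous hf) continuous_const,
    ?_, fun x t hxt => ?_⟩
  · simp only [div_eq_mul_inv]
    exact (ContDiff.contDiffOn hg).mul ((ContDiff.contDiffOn hf).inv fun p hp => hp)
  have hxt : f x t ≠ 0 := hxt
  have hx : ∀ τ, f x τ ≠ 0 → deriv (fun y => g y τ / f y τ) x
      = (px g x τ * f x τ - g x τ * px f x τ) / f x τ ^ 2 := fun τ hτ =>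
    ((hg.hasDerivAt_px x τ).fun_div (hf.hasDerivAt_px x τ) hτ).deriv
  have hev : (fun τ => deriv (fun y => g y τ / f y τ) x)
      =ᶠ[𝓝 t] fun τ => (px g x τ * f x τ - g x τ * px f x τ) / f x τ ^ 2 := by
    filter_upwards [(hf.hasDerivAt_pt x t).continuousAt.eventually_ne hxt] with τ hτ
    exact hx τ hτ
  have hft := hf.hasDerivAt_pt x t
  have hgt := hg.hasDerivAt_pt x t
  have hfxt := hf.px_isSmooth.hasDerivAt_pt x t
  have hgxt := hg.px_isSmooth.hasDerivAt_pt x t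
  rw [hf.pt_px] at hfxt
  rw [hg.pt_px] at hgxt
  have hd := (((hgxt.fun_mul hft).fun_sub (hgt.fun_mul hfxt)).fun_div (hft.fun_pow 2)
    (pow_ne_zero 2 hxt)).deriv
  rw [hev.deriv_eq, hd, hx t hxt, ofReal_norm_sq, map_div₀]
  have e1 := h1 x t
  have e2 := h2 x t
  have e3 := h3 x t
  have hc : conj (f x t) ≠ 0 := (map_ne_zero _).2 hxt
  generalize conj (f x t) = fs at *
  generalize conj (g x t) = gs at *
  generalize conj (pt f x t) = fts at *
  field_simp
  push_cast
  -- The first equation gives u_xt + u = -2g(f_xt f - f_x f_t)/f³. The other two give (f_xt f - f_x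
  -- f_t)f* = -iδ g*(g_x f - g f_x), and g_x f - g f_x = f²u_x.
  linear_combination f x t * (f x t * fs * e1 - 2 * g x t * f x t * e2 + 2 * g x t * px f x t * e3)

lemma hasDerivAt_div_conj (hf : IsSmooth f) (h3 : BilinearT δ f g) {x t : ℝ} (h0 : f x t ≠ 0) :
    HasDerivAt (fun τ => f x τ / conj (f x τ))
      (-(Complex.I * δ * (g x t * conj (g x t))) / conj (f x t) ^ 2) t := by
  have hft := hf.hasDerivAt_pt x t
  have h := hft.fun_div hft.star ((map_ne_zero (starRingEnd ℂ)).2 h0)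
  convert! h using 2
  have e3 := h3 x t
  simp only [← starRingEnd_apply]
  linear_combination -e3

lemma norm_sq_eq_log_deriv (hδ : δ = 1 ∨ δ = -1) (hf : IsSmooth f) (h3 : BilinearT δ f g)
    {x t : ℝ} (h0 : f x t ≠ 0) :
    (∃ L : ℝ → ℂ, IsLogBranchNear L (fun τ => f x τ / conj (f x τ)) t) ∧
      ∀ L : ℝ → ℂ, IsLogBranchNear L (fun τ => f x τ / conj (f x τ)) t →
        ∃ d : ℂ, HasDerivAt L d t ∧
          ((‖g x t / f x t‖ ^ 2 : ℝ) : ℂ) = Complex.I * (δ : ℂ) * d := by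
  have hc : conj (f x t) ≠ 0 := (map_ne_zero _).2 h0
  refine ⟨exists_isLogBranchNear ?_ (div_ne_zero h0 hc), fun L hL =>
    ⟨_, hL.hasDerivAt (hasDerivAt_div_conj hf h3 h0), ?_⟩⟩
  · filter_upwards [(hf.hasDerivAt_pt x t).continuousAt.eventually_ne h0] with τ hτ
    exact (hasDerivAt_div_conj hf h3 hτ).continuousAt
  · have hδ2 : (δ : ℂ) ^ 2 = 1 := by rcases hδ with rfl | rfl <;> simp
    rw [ofReal_norm_sq, map_div₀]
    field_simp
    linear_combination (g x t * conj (g x t)) * (δ : ℂ) ^ 2 * Complex.I_sq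
      - (g x t * conj (g x t)) * hδ2

lemma norm_sq_eq_arctan_deriv (hδ : δ = 1 ∨ δ = -1) (hf : IsSmooth f) (h3 : BilinearT δ f g)
    {x t : ℝ} (h0 : (f x t).im ≠ 0) :
    ∃ d : ℝ, HasDerivAt (fun τ => Real.arctan ((f x τ).re / (f x τ).im)) d t ∧
      ‖g x t / f x t‖ ^ 2 = 2 * δ * d := by
  have hft := hf.hasDerivAt_pt x t
  have hre : HasDerivAt (fun τ => (f x τ).re) (pt f x t).re t :=
    Complex.reCLM.hasFDerivAt.comp_hasDerivAt t hft
  have him : HasDerivAt (fun τ => (f x τ).im) (pt f x t).im t :=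
    Complex.imCLM.hasFDerivAt.comp_hasDerivAt t hft
  refine ⟨_, (hre.fun_div him h0).arctan, ?_⟩
  -- The equation is purely imaginary, so nothing is lost.
  have e3 := congrArg Complex.im (h3 x t)
  simp only [Complex.add_im, Complex.sub_im, Complex.mul_im, Complex.mul_re, Complex.conj_re,
    Complex.conj_im, Complex.I_re, Complex.I_im, Complex.ofReal_re, Complex.ofReal_im,
    Complex.zero_im] at e3
  have hδ2 : δ ^ 2 = 1 := by rcases hδ with rfl | rfl <;> simp
  rw [norm_div, div_pow, ← Complex.normSq_eq_norm_sq, ← Complex.normSq_eq_norm_sq,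
    Complex.normSq_apply, Complex.normSq_apply]
  have hpos : (f x t).re * (f x t).re + (f x t).im * (f x t).im ≠ 0 := by
    have := mul_self_pos.2 h0
    nlinarith [mul_self_nonneg (f x t).re]
  have hd : 1 / (1 + ((f x t).re / (f x t).im) ^ 2)
        * (((pt f x t).re * (f x t).im - (f x t).re * (pt f x t).im) / (f x t).im ^ 2)
      = ((pt f x t).re * (f x t).im - (f x t).re * (pt f x t).im)
        / ((f x t).re * (f x t).re + (f x t).im * (f x t).im) := by
    have h1 : 1 + ((f x t).re / (f x t).im) ^ 2
        = ((f x t).re * (f x t).re + (f x t).im * (f x t).im) / (f x t).im ^ 2 := by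
      field_simp; ring
    rw [h1]
    field_simp
  rw [hd, ← mul_div_assoc, div_left_inj' hpos]
  linear_combination δ * e3 - ((g x t).re ^ 2 + (g x t).im ^ 2) * hδ2

end Reduction

theorem bilinear_wronskian {N : ℕ} (hN : 1 ≤ N) {A T : Matrix (Fin (2 * N)) (Fin (2 * N)) ℂ}
    {C : Fin (2 * N) → ℂ} {δ : ℝ} (hA : IsUnit A) (hT : IsUnit T)
    (hAT : A * T = T * conjMat A)
    (hTT : T * conjMat T = (δ : ℂ) • (1 : Matrix (Fin (2 * N)) (Fin (2 * N)) ℂ)) :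
    IsSmooth (wronskF A T C) ∧ IsSmooth (wronskG A T C) ∧
      BilinearGF (wronskF A T C) (wronskG A T C) ∧
      BilinearXT δ (wronskF A T C) (wronskG A T C) ∧
      BilinearT δ (wronskF A T C) (wronskG A T C) := by
  obtain ⟨ε, c, c', hc, hw⟩ := exists_wronskian_words (C := C) hN hA hT hAT hTT
  have hflow := isFlow_pair (C := C) hA hAT
  set f := wronskF A T C
  set g := wronskG A T C
  set f₀ := wordDet (evolB A) (pair A T C) (psiWord hN (false, 0)) with hf₀
  set g₀ := wordDet (evolB A) (pair A T C) (psiWord hN (true, 0)) with hg₀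
  set F := wordDet (evolB A) (pair A T C) (psiWord hN (false, N)) with hF
  set G := wordDet (evolB A) (pair A T C) (firstWord hN (false, N) (false, 0)) with hG
  have ef : f = f₀ := by funext x t; exact (hw x t).1
  have eg : g = fun x t => ε * g₀ x t := by funext x t; exact (hw x t).2.1
  have efs : (fun x t => conj (f x t)) = fun x t => c * F x t := by
    funext x t; exact (hw x t).2.2.1
  have egs : (fun x t => conj (g x t)) = fun x t => c' * G x t := by
    funext x t; exact (hw x t).2.2.2
  have sf : IsSmooth f := ef ▸ hflow.isSmooth_wordDet _
  have sg : IsSmooth g := eg ▸ (hflow.isSmooth_wordDet _).const_mul ε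
  have e1 := hflow.bilinear_first hN hf₀ hg₀
  have e2 := hflow.bilinear_second hN hf₀ hg₀ hF hG
  have e3 := hflow.bilinear_third hN hf₀ hg₀ hF hG
  have ht : BilinearT δ f g := by
    intro x t
    rw [← pt_conj sf, congrFun (congrFun efs x) t, congrFun (congrFun egs x) t, efs,
      pt_const_mul, ef, eg]
    linear_combination c * e3 x t - 1 / 2 * g₀ x t * G x t * hc
  refine ⟨sf, sg, ?_, ?_, ht⟩
  · intro x t
    have hgt : pt g = fun x t => ε * pt g₀ x t := by
      funext x t; rw [eg, pt_const_mul]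
    rw [hgt, px_const_mul, eg, px_const_mul, ef]
    linear_combination ε * e1 x t
  · intro x t
    have h := ht.deriv_fst sf sg x t
    -- The word identity yields this conjugate-side half; adding the x-derivative of `BilinearT`
    -- gives `BilinearXT`.
    have h2 : f x t * conj (px (pt f) x t) - pt f x t * conj (px f x t)
        = Complex.I * δ * (g x t * conj (px g x t)) := by
      have hps : (fun x t => conj (pt f x t)) = fun x t => c * pt F x t := by
        funext x t
        rw [← pt_conj sf, efs, pt_const_mul]
      rw [← px_conj sf.pt_isSmooth, ← px_conj sf, ← px_conj sg, hps, efs, egs, px_const_mul,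
        px_const_mul, px_const_mul, ef, eg]
      linear_combination c * e2 x t + 1 / 2 * g₀ x t * px G x t * hc
    linear_combination h + h2

end FokasLenells

end

theorem theorem21 (N : ℕ) (hN : 1 ≤ N) (δ : ℝ) (hδ : δ = 1 ∨ δ = -1)
    (A T : Matrix (Fin (2 * N)) (Fin (2 * N)) ℂ) (C : Fin (2 * N) → ℂ)
    (hA : IsUnit A) (hT : IsUnit T)
    (hAT : A * T = T * FokasLenells.conjMat A)
    (hTT : T * FokasLenells.conjMat T = (δ : ℂ) • (1 : Matrix (Fin (2 * N)) (Fin (2 * N)) ℂ))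
    (f g u : ℝ → ℝ → ℂ)
    (hf : f = FokasLenells.wronskF A T C) (hg : g = FokasLenells.wronskG A T C)
    (hu : u = FokasLenells.solU A T C) :
    -- `u = g / f` solves the Fokas–Lenells equation wherever `f ≠ 0`
    FokasLenells.IsFLSolutionOn δ {p : ℝ × ℝ | f p.1 p.2 ≠ 0} u ∧
    -- the (everywhere smooth) double Wronskians satisfy the bilinear equations
    ContDiff ℝ ∞ (fun p : ℝ × ℝ => f p.1 p.2) ∧
    ContDiff ℝ ∞ (fun p : ℝ × ℝ => g p.1 p.2) ∧
    (∀ x t : ℝ, FokasLenells.hirota 1 1 g f x t + g x t * f x t = 0) ∧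
    (∀ x t : ℝ, FokasLenells.hirota 1 1 f (fun x t => conj (f x t)) x t
      + Complex.I * (δ : ℂ) * FokasLenells.hirota 1 0 g (fun x t => conj (g x t)) x t = 0) ∧
    (∀ x t : ℝ, FokasLenells.hirota 0 1 f (fun x t => conj (f x t)) x t
      + Complex.I * (δ : ℂ) * (g x t * conj (g x t)) = 0) ∧
    -- `|u|² = i δ (ln (f / f*))_t`, for every local continuous branch of the logarithm
    (∀ x t : ℝ, f x t ≠ 0 →
      (∃ L : ℝ → ℂ, FokasLenells.IsLogBranchNear L (fun τ => f x τ / conj (f x τ)) t) ∧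
      ∀ L : ℝ → ℂ, FokasLenells.IsLogBranchNear L (fun τ => f x τ / conj (f x τ)) t →
        ∃ d : ℂ, HasDerivAt L d t ∧ ((‖u x t‖ ^ 2 : ℝ) : ℂ) = Complex.I * (δ : ℂ) * d) ∧
    -- `|u|² = 2 δ (arctan (Re f / Im f))_t`
    (∀ x t : ℝ, (f x t).im ≠ 0 →
      ∃ d : ℝ, HasDerivAt (fun τ => Real.arctan ((f x τ).re / (f x τ).im)) d t ∧
        ‖u x t‖ ^ 2 = 2 * δ * d) := by
  obtain ⟨sf, sg, h1, h2, h3⟩ := FokasLenells.bilinear_wronskian (C := C) hN hA hT hAT hTT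
  subst hf hg hu
  refine ⟨FokasLenells.isFLSolutionOn_of_bilinear sf sg h1 h2 h3, sf, sg, fun x t => ?_,
    fun x t => ?_, fun x t => ?_,
    fun x t hx => FokasLenells.norm_sq_eq_log_deriv hδ sf h3 hx,
    fun x t hx => FokasLenells.norm_sq_eq_arctan_deriv hδ sf h3 hx⟩
  · rw [FokasLenells.hirota_one_one sg sf]
    exact h1 x t
  · have h := h3.deriv_fst sf sg x t
    rw [FokasLenells.hirota_one_one sf sf.star, FokasLenells.hirota_one_zero sg sg.star,
      FokasLenells.px_conj sf, FokasLenells.px_conj sg, FokasLenells.pt_conj sf,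
      funext fun x => funext fun t => FokasLenells.pt_conj sf x t,
      FokasLenells.px_conj sf.pt_isSmooth]
    -- Subtracting the differentiated equation flips the signs of f_t f*_x, f f*_xt and g g*_x, as
    -- Hirota's operators demand.
    linear_combination 2 * h2 x t - h
  · rw [FokasLenells.hirota_zero_one sf sf.star, FokasLenells.pt_conj sf]
    exact h3 x t
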